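/- **Notation.** Let $\mathbb{T}=\{|z|=1\}$, $\mathbb{D}=\{|z|<1\}$, and let $dm=d\theta/(2\pi)$ be normalized Lebesgue measure on $\mathbb{T}$; "a.e." refers to $m$. For a sequence $\{\gamma_g\}_{g\ge 0}$ of points of $\mathbb{D}$ put $\rho_n=(1-|\gamma_n|^2)^{1/2}$ and, for $\xi\in\mathbb{T}$, $$\Omega_n(\xi)=\rho_n^{-1}\begin{pmatrix}1&\bar\gamma_n\xi^{-n}\\ \gamma_n\xi^n&1\end{pmatrix},\qquad \Pi_n(\xi)=\Omega_n(\xi)\cdots\Omega_0(\xi),\qquad O(\xi,\{\gamma_g\})=\sup_{n\ge 0}\|\Pi_n(\xi)-I\|_2\in[0,\infty],$$ where $\|A\|_2=\sqrt{\operatorname{tr}(A^*A)}$. The conjecture **qNCC-II** is the assertion: there are $\epsilon>0$ and an absolute constant $C$ such that, for every $\{\gamma_g\}\subset\mathbb{D}$ with $\|\{\gamma_g\}\|_{\ell^2}\le\epsilon$, $$\int_{\mathbb{T}}\log\bigl(1+O^2(\xi,\{\gamma_g\})\bigr)\,dm\le C\,\|\{\gamma_g\}\|_{\ell^2}^2 .$$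 For a probability measure $\sigma$ on $\mathbb{T}$ with infinite support let $\Phi_n$ be its monic orthogonal polynomials, $\phi_n=\Phi_n/\|\Phi_n\|_{L^2(\sigma)}$, and $\phi_n^*(z)=z^n\overline{\phi_n(1/\bar z)}$. Its Schur parameters are $\gamma_n=-\overline{\Phi_{n+1}(0)}$, equivalently $\Phi_{n+1}=z\Phi_n-\bar\gamma_n\Phi_n^*$, where $\Phi_n^*(z)=z^n\overline{\Phi_n(1/\bar z)}$. Let $w$ be the density of the absolutely continuous part of $\sigma$ with respect to $m$. The measure $\sigma$ is in the Szegő class if $\int_{\mathbb{T}}\log w\,dm>-\infty$; then $$D_\sigma(z)=\exp\Bigl(\tfrac12\int_{\mathbb{T}}\frac{\xi+z}{\xi-z}\log w(\xi)\,dm(\xi)\Bigr)\quad(z\in\mathbb{D}),$$ and $D_\sigma(\xi)$, for $\xi\in\mathbb{T}$, denotes the radial limit $\lim_{r\uparrow 1}D_\sigma(r\xi)$. **Theorem.** Suppose that qNCC-II holds and let $\{\gamma_g\}_{g\ge0}\in\ell^2$ with $\gamma_g\in\mathbb{D}$ for all $g$. Then: 1. $\lim_{n\to\infty}\Pi_n(\xi)$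 exists for a.e. $\xi\in\mathbb{T}$. 2. If $\sigma$ is a probability measure on $\mathbb{T}$ with infinite support whose Schur parameters are $\{\gamma_g\}$, then $\sigma$ is in the Szegő class and, for a.e. $\xi\in\mathbb{T}$, the boundary value $D_\sigma(\xi)$ exists, is nonzero, and $\lim_{n\to\infty}\phi_n^*(\xi,\sigma)=D_\sigma(\xi)^{-1}$. -/

import Mathlib

open MeasureTheory Filter Topology Polynomial
open scoped ENNReal ComplexConjugate Matrix

noncomputable section

/-- The unit circle carries its Borel σ-algebra. -/
instance instMeasurableSpaceUnitCircle : MeasurableSpace Circle := borel Circle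

instance instBorelSpaceUnitCircle : BorelSpace Circle := ⟨rfl⟩

/-- Normalized Lebesgue measure `dm = dθ / (2π)` on the unit circle. -/
def circleMeasure : Measure Circle :=
  haveI : Fact (0 < 2 * Real.pi) := ⟨Real.two_pi_pos⟩
  (AddCircle.haarAddCircle (T := 2 * Real.pi)).map AddCircle.toCircle

instance instIsProbabilityMeasureCircleMeasure : IsProbabilityMeasure circleMeasure := by
  haveI : Fact (0 < 2 * Real.pi) := ⟨Real.two_pi_pos⟩
  exact Measure.isProbabilityMeasure_map AddCircle.continuous_toCircle.measurable.aemeasurable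

/-! ### The matrix products -/

/-- The transfer matrix `Ω_n(ξ) = ρ_n⁻¹ [[1, conj γ_n ξ⁻ⁿ], [γ_n ξⁿ, 1]]`,
with `ρ_n = (1 - |γ_n|²)^{1/2}`. -/
def transferMatrix (γ : ℕ → ℂ) (n : ℕ) (ξ : Circle) : Matrix (Fin 2) (Fin 2) ℂ :=
  ((Real.sqrt (1 - ‖γ n‖ ^ 2) : ℝ) : ℂ)⁻¹ •
    !![1, conj (γ n) * ((ξ : ℂ) ^ n)⁻¹; γ n * (ξ : ℂ) ^ n, 1]

/-- The ordered product `Π_n = Ω_n ⋯ Ω_0`. -/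
def transferProd (γ : ℕ → ℂ) : ℕ → Circle → Matrix (Fin 2) (Fin 2) ℂ
  | 0, ξ => transferMatrix γ 0 ξ
  | n + 1, ξ => transferMatrix γ (n + 1) ξ * transferProd γ n ξ

/-- The Frobenius norm `‖A‖₂ = (tr (A* A))^{1/2}`. -/
def frobNorm (A : Matrix (Fin 2) (Fin 2) ℂ) : ℝ :=
  Real.sqrt (Matrix.trace (Aᴴ * A)).re

/-- The maximal function `O(ξ) = sup_n ‖Π_n(ξ) - I‖₂`, with values in `[0, ∞]`. -/
def maximalO (γ : ℕ → ℂ) (ξ : Circle) : ℝ≥0∞ :=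
  ⨆ n : ℕ, ENNReal.ofReal (frobNorm (transferProd γ n ξ - 1))

/-- The conjecture qNCC-II: there are `ε > 0` and an absolute constant `C` such that
`∫ log (1 + O²) dm ≤ C ‖γ‖²` for all `γ` with values in the open unit disc and `ℓ²` norm at most
`ε`. The integrand takes values in `[0, ∞]`. -/
def QNCCII : Prop :=
  ∃ ε : ℝ, 0 < ε ∧ ∃ C : ℝ, ∀ γ : lp (fun _ : ℕ => ℂ) 2, (∀ n, ‖γ n‖ < 1) → ‖γ‖ ≤ ε →
    ∫⁻ ξ, (ENNReal.log (1 + maximalO γ ξ ^ 2)).toENNReal ∂circleMeasure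
      ≤ ENNReal.ofReal (C * ‖γ‖ ^ 2)

/-! ### Orthogonal polynomials on the unit circle -/

/-- `⟨P, Q⟩_σ = ∫ P conj(Q) dσ`. -/
def polyInner (σ : Measure Circle) (P Q : ℂ[X]) : ℂ :=
  ∫ ξ : Circle, P.eval (ξ : ℂ) * conj (Q.eval (ξ : ℂ)) ∂σ

/-- The monic orthogonal polynomials `Φ_n` of `σ`, by Gram-Schmidt applied to `1, z, z², …`. -/
def monicOPUC (σ : Measure Circle) (n : ℕ) : ℂ[X] :=
  X ^ n - ∑ j : Fin n, C (polyInner σ (X ^ n) (monicOPUC σ j) /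
    polyInner σ (monicOPUC σ j) (monicOPUC σ j)) * monicOPUC σ j

theorem integrable_poly_mul (σ : Measure Circle) [IsProbabilityMeasure σ] (P Q : ℂ[X]) :
    Integrable (fun ξ : Circle => P.eval (ξ : ℂ) * conj (Q.eval (ξ : ℂ))) σ := by
  have hc : Continuous (fun ξ : Circle => P.eval (ξ : ℂ) * conj (Q.eval (ξ : ℂ))) :=
    (P.continuous.comp continuous_subtype_val).mul
      (Complex.continuous_conj.comp (Q.continuous.comp continuous_subtype_val))
  exact hc.integrable_of_hasCompactSupport (HasCompactSupport.of_compactSpace _)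

theorem polyInner_self_ne_zero (σ : Measure Circle) [IsProbabilityMeasure σ]
    (hσ : σ.support.Infinite) {P : ℂ[X]} (hP : P ≠ 0) : polyInner σ P P ≠ 0 := by
  intro h
  have hint := (integrable_poly_mul σ P P).norm
  have h1 : ∫ ξ : Circle, ‖P.eval (ξ : ℂ)‖ ^ 2 ∂σ = 0 := by
    have : polyInner σ P P = ((∫ ξ : Circle, ‖P.eval (ξ : ℂ)‖ ^ 2 ∂σ : ℝ) : ℂ) := by
      rw [polyInner, ← integral_complex_ofReal]
      congr 1; ext ξ
      rw [Complex.mul_conj, Complex.normSq_eq_norm_sq]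
    rw [this] at h
    exact_mod_cast h
  have hint2 : Integrable (fun ξ : Circle => ‖P.eval (ξ : ℂ)‖ ^ 2) σ := by
    refine hint.congr (Eventually.of_forall fun ξ => ?_)
    simp [sq]
  rw [integral_eq_zero_iff_of_nonneg (fun ξ => by positivity) hint2] at h1
  have hcl : IsClosed {ξ : Circle | P.eval (ξ : ℂ) = 0} :=
    isClosed_eq (P.continuous.comp continuous_subtype_val) continuous_const
  have hae : {ξ : Circle | P.eval (ξ : ℂ) = 0} ∈ ae σ := by
    filter_upwards [h1] with ξ hξ
    simpa using hξ
  refine hσ (Set.Finite.subset ?_ (Measure.support_subset_of_isClosed hcl hae))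
  refine Set.Finite.of_finite_image (f := fun ξ : Circle => (ξ : ℂ)) ?_
    Circle.coe_injective.injOn
  refine (P.roots.toFinset.finite_toSet).subset ?_
  rintro _ ⟨ξ, hξ, rfl⟩
  simpa [hP] using hξ

theorem polyInner_conj (σ : Measure Circle) (P Q : ℂ[X]) :
    conj (polyInner σ P Q) = polyInner σ Q P := by
  rw [polyInner, polyInner, ← integral_conj]
  congr 1; ext ξ
  simp [mul_comm]

theorem polyInner_sub_left (σ : Measure Circle) [IsProbabilityMeasure σ] (P Q R : ℂ[X]) :
    polyInner σ (P - Q) R = polyInner σ P R - polyInner σ Q R := by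
  rw [polyInner, polyInner, polyInner,
    ← integral_sub (integrable_poly_mul σ P R) (integrable_poly_mul σ Q R)]
  congr 1; ext ξ
  simp [sub_mul]

theorem polyInner_sum_left (σ : Measure Circle) [IsProbabilityMeasure σ] {ι : Type*}
    (s : Finset ι) (c : ι → ℂ) (P : ι → ℂ[X]) (R : ℂ[X]) :
    polyInner σ (∑ i ∈ s, C (c i) * P i) R = ∑ i ∈ s, c i * polyInner σ (P i) R := by
  simp only [polyInner, ← integral_const_mul]
  rw [← integral_finsetSum s fun i _ => (integrable_poly_mul σ (P i) R).const_mul (c i)]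
  congr 1; ext ξ
  simp [eval_finsetSum, Finset.sum_mul, mul_assoc]

theorem polyInner_eq_zero_of_natDegree_lt (σ : Measure Circle) [IsProbabilityMeasure σ]
    {n : ℕ} {P Q : ℂ[X]} (hQ : ∀ j < n, polyInner σ Q (X ^ j) = 0) (hP : P.natDegree < n) :
    polyInner σ P Q = 0 := by
  rw [P.as_sum_range_C_mul_X_pow, polyInner_sum_left]
  refine Finset.sum_eq_zero fun i hi => ?_
  rw [← polyInner_conj, hQ i (by have := Finset.mem_range.1 hi; omega)]
  simp

/-- `Φ_n` is monic of degree `n` and orthogonal to `z^j` for `j < n`. -/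
theorem monicOPUC_spec (σ : Measure Circle) [IsProbabilityMeasure σ]
    (hσ : σ.support.Infinite) (n : ℕ) :
    (monicOPUC σ n).Monic ∧ (monicOPUC σ n).natDegree = n ∧
      ∀ j < n, polyInner σ (monicOPUC σ n) (X ^ j) = 0 := by
  induction n using Nat.strong_induction_on with
  | _ n ih =>
  have hdeg : (∑ j : Fin n, C (polyInner σ (X ^ n) (monicOPUC σ j) /
      polyInner σ (monicOPUC σ j) (monicOPUC σ j)) * monicOPUC σ j).degree
        < ((X : ℂ[X]) ^ n).degree := by
    rw [degree_X_pow]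
    refine (degree_sum_le _ _).trans_lt ((Finset.sup_lt_iff (WithBot.bot_lt_coe n)).2 ?_)
    intro j _
    rw [← smul_eq_C_mul]
    refine (degree_smul_le _ _).trans_lt ?_
    rw [degree_eq_natDegree (ih j j.2).1.ne_zero, (ih j j.2).2.1]
    exact Nat.cast_lt.2 j.2
  have hmon : (monicOPUC σ n).Monic := by
    rw [monicOPUC]; exact (monic_X_pow n).sub_of_left hdeg
  have hnd : (monicOPUC σ n).natDegree = n := by
    refine natDegree_eq_of_degree_eq_some ?_
    rw [monicOPUC, degree_sub_eq_left_of_degree_lt hdeg, degree_X_pow]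
  have hoff : ∀ j < n, ∀ k < n, j ≠ k → polyInner σ (monicOPUC σ j) (monicOPUC σ k) = 0 := by
    intro j hj k hk hjk
    rcases lt_or_gt_of_ne hjk with h | h
    · exact polyInner_eq_zero_of_natDegree_lt σ (ih k hk).2.2 (by rw [(ih j hj).2.1]; exact h)
    · rw [← polyInner_conj,
        polyInner_eq_zero_of_natDegree_lt σ (ih j hj).2.2 (by rw [(ih k hk).2.1]; exact h)]
      simp
  have horth : ∀ k < n, polyInner σ (monicOPUC σ n) (monicOPUC σ k) = 0 := by
    intro k hk
    rw [monicOPUC, polyInner_sub_left, polyInner_sum_left,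
      Finset.sum_eq_single (⟨k, hk⟩ : Fin n)]
    · rw [div_mul_cancel₀ _ (polyInner_self_ne_zero σ hσ (ih k hk).1.ne_zero), sub_self]
    · intro j _ hj
      rw [hoff j j.2 k hk (fun h => hj (Fin.ext h)), mul_zero]
    · simp
  refine ⟨hmon, hnd, fun j hj => ?_⟩
  have hX : polyInner σ (X ^ j) (monicOPUC σ n) = 0 := by
    have h1 : polyInner σ (monicOPUC σ j) (monicOPUC σ n) = 0 := by
      rw [← polyInner_conj, horth j hj]; simp
    have h2 := h1
    rw [monicOPUC.eq_1 σ j, polyInner_sub_left, polyInner_sum_left] at h2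
    rw [Finset.sum_eq_zero, sub_zero] at h2
    · exact h2
    · intro i _
      rw [← polyInner_conj σ (monicOPUC σ n), horth i (i.2.trans hj)]; simp
  rw [← polyInner_conj, hX]; simp

/-- The orthonormal polynomials `φ_n = Φ_n / ‖Φ_n‖_{L²(σ)}`. -/
def orthonormalOPUC (σ : Measure Circle) (n : ℕ) : ℂ[X] :=
  C ((Real.sqrt (∫ ξ : Circle, ‖(monicOPUC σ n).eval (ξ : ℂ)‖ ^ 2 ∂σ) : ℝ) : ℂ)⁻¹ *
    monicOPUC σ n

/-- For `Q` of degree at most `n`, the polynomial `Q*(z) = zⁿ conj (Q (1 / conj z))`: the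
coefficients are conjugated and reversed. -/
def starPoly (n : ℕ) (Q : ℂ[X]) : ℂ[X] :=
  (Q.map (starRingEnd ℂ)).reflect n

/-- The Schur (Verblunsky) parameters of `σ`, in the normalization
`Φ_{n+1} = z Φ_n - conj γ_n Φ_n*`, that is, `γ_n = - conj (Φ_{n+1}(0))`. -/
def schurParam (σ : Measure Circle) (n : ℕ) : ℂ :=
  -conj ((monicOPUC σ (n + 1)).eval 0)

/-! ### The Szegő class and the Szegő function -/

/-- The density `w` of the absolutely continuous part of `σ` with respect to `m`. -/
def acDensity (σ : Measure Circle) (ξ : Circle) : ℝ :=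
  (σ.rnDeriv circleMeasure ξ).toReal

/-- The Szegő condition `∫ log w dm > -∞`. As `w` is integrable, the positive part of
`log w` always is, so the condition says that `w > 0` a.e. and that `log w` is integrable. -/
def InSzegoClass (σ : Measure Circle) : Prop :=
  (∀ᵐ ξ ∂circleMeasure, 0 < acDensity σ ξ) ∧
    Integrable (fun ξ => Real.log (acDensity σ ξ)) circleMeasure

/-- The Szegő function `D_σ(z) = exp (½ ∫ (ξ + z) / (ξ - z) log w(ξ) dm(ξ))`, for `|z| < 1`. -/
def szegoFunction (σ : Measure Circle) (z : ℂ) : ℂ :=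
  Complex.exp ((1 / 2 : ℂ) * ∫ ξ : Circle, (((ξ : ℂ) + z) / ((ξ : ℂ) - z)) *
    ((Real.log (acDensity σ ξ) : ℝ) : ℂ) ∂circleMeasure)

/-- `d` is the boundary value `D_σ(ξ)` of the Szegő function, i.e. its radial limit at `ξ`. -/
def IsSzegoBoundaryValue (σ : Measure Circle) (ξ : Circle) (d : ℂ) : Prop :=
  Tendsto (fun r : ℝ => szegoFunction σ ((r : ℂ) * (ξ : ℂ))) (𝓝[<] 1) (𝓝 d)

end

/-! ### Integrals over the unit circle -/

/-! Convergence of the products comes from applying qNCC-II to tails. Let $\delta_N$ be $\gamma$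
with the terms up to $N$ replaced by $0$. Then $\Pi_n(\gamma)=\Pi_n(\delta_N)\Pi_N(\gamma)$ for
$n\ge N$, and $\int\log(1+O^2(\cdot,\delta_N))\,dm\le C\|\delta_N\|^2\to0$. Hence at almost every
$\xi$ there are arbitrarily large $N$ with $O(\xi,\delta_N)$ as small as desired
(`ae_exists_transferProd_lpTail_near`), and this makes $\Pi_n(\xi)$ Cauchy
(`exists_tendsto_transferProd`).

For the measure, write $(a_n,b_n)$ for the first row of $\Pi_n$, so that $|a_n|^2-|b_n|^2=1$.
Szegő's recursion gives $\overline{\phi_{n+1}^*}=a_n-b_n\xi^{-1}$ on the circle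
(`conj_eval_starPoly_succ_eq`), so $\phi_n^*$ converges a.e. to some $L\ne0$.

The Bernstein–Szegő measures $|\phi_n^*|^{-2}dm$ have the moments of $\sigma$ up to order $n$ and
tend weakly to $\sigma$. Fatou's lemma applied to them gives $|L|^{-2}\le w$. Fatou's lemma applied
to $\int|\phi_n^*|^2d\sigma=1$ gives $\int|L|^2w\,dm\le1$. Therefore $w=|L|^{-2}$ a.e.
(`acDensity_eq_inv_norm_sq`).

The maximal function of a single tail yields an integrable majorant of $|\log|\phi_n^*||$ for all
large $n$ (`abs_log_norm_starPoly_le`). Thus $\log w=-2\log|L|$ is integrable, and dominated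
convergence in the Schwarz formula gives $1/\phi_n^*(z)\to D_\sigma(z)$ inside the disc. The
functions $1/\phi_n^*$ have norm $1$ in $L^2(m)$ and converge a.e., hence in $L^1(m)$. So $D_\sigma$
is the Poisson integral of $1/L$ (`szegoFunction_eq_poissonIntegral`), and Fatou's radial limit
theorem identifies its boundary values. -/

theorem integral_circleMeasure {E : Type*} [NormedAddCommGroup E] [NormedSpace ℝ E]
    {f : ℂ → E} (hf : Continuous fun ξ : Circle => f ξ) :
    ∫ ξ : Circle, f ξ ∂circleMeasure = Real.circleAverage f 0 1 := by
  have : Fact (0 < 2 * Real.pi) := ⟨Real.two_pi_pos⟩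
  rw [circleMeasure, integral_map AddCircle.continuous_toCircle.measurable.aemeasurable
    hf.aestronglyMeasurable, AddCircle.integral_haarAddCircle, Real.circleAverage,
    ← AddCircle.intervalIntegral_preimage (2 * Real.pi) 0]
  simp [AddCircle.toCircle, circleMap]

theorem Continuous.integrable_circle {E : Type*} [NormedAddCommGroup E]
    {μ : Measure Circle} [IsFiniteMeasure μ] {f : Circle → E} (hf : Continuous f) :
    Integrable f μ :=
  hf.integrable_of_hasCompactSupport (HasCompactSupport.of_compactSpace _)

theorem DiffContOnCl.continuous_circle {f : ℂ → ℂ} (hf : DiffContOnCl ℂ f (Metric.ball 0 1)) :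
    Continuous fun ξ : Circle => f ξ := by
  have h := hf.continuousOn
  rw [closure_ball (0 : ℂ) one_ne_zero] at h
  exact h.comp_continuous continuous_subtype_val fun ξ => by simpa using (Circle.norm_coe ξ).le

theorem sub_ne_zero_of_norm_lt_one {z : ℂ} (hz : ‖z‖ < 1) (ξ : Circle) : (ξ : ℂ) - z ≠ 0 := by
  intro h
  have : ‖(ξ : ℂ)‖ = ‖z‖ := by rw [sub_eq_zero.1 h]
  rw [Circle.norm_coe] at this
  linarith

theorem DiffContOnCl.integral_circleMeasure {f : ℂ → ℂ}
    (hf : DiffContOnCl ℂ f (Metric.ball 0 1)) :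
    ∫ ξ : Circle, f ξ ∂circleMeasure = f 0 := by
  rw [_root_.integral_circleMeasure hf.continuous_circle]
  exact DiffContOnCl.circleAverage (by simpa using hf)

theorem DiffContOnCl.integral_circleMeasure_cauchy {f : ℂ → ℂ}
    (hf : DiffContOnCl ℂ f (Metric.ball 0 1)) {z : ℂ} (hz : ‖z‖ < 1) :
    ∫ ξ : Circle, (ξ : ℂ) / (ξ - z) * f ξ ∂circleMeasure = f z := by
  have hc : Continuous fun ξ : Circle => (ξ : ℂ) / (ξ - z) * f ξ :=
    (continuous_subtype_val.div (continuous_subtype_val.sub continuous_const)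
      (sub_ne_zero_of_norm_lt_one hz)).mul hf.continuous_circle
  rw [_root_.integral_circleMeasure (f := fun ξ : ℂ => ξ / (ξ - z) * f ξ) hc]
  have := DiffContOnCl.circleAverage_smul_div (R := 1) (c := 0) (w := z) (f := f)
    (by simpa using hf) (by simpa using hz)
  simpa using this

theorem continuous_poissonKernel_circle {z : ℂ} (hz : ‖z‖ < 1) :
    Continuous fun ξ : Circle => poissonKernel 0 z ξ := by
  simp only [poissonKernel_def, sub_zero]
  refine Continuous.div (by fun_prop) (by fun_prop) fun ξ => ?_
  exact pow_ne_zero _ (norm_ne_zero_iff.2 (sub_ne_zero_of_norm_lt_one hz ξ))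

theorem DiffContOnCl.integral_poissonKernel {f : ℂ → ℂ}
    (hf : DiffContOnCl ℂ f (Metric.ball 0 1)) {z : ℂ} (hz : ‖z‖ < 1) :
    ∫ ξ : Circle, poissonKernel 0 z ξ • f ξ ∂circleMeasure = f z := by
  rw [_root_.integral_circleMeasure (f := fun ξ : ℂ => poissonKernel 0 z ξ • f ξ)
    ((continuous_poissonKernel_circle hz).smul hf.continuous_circle)]
  exact hf.circleAverage_poissonKernel_smul (by simpa using hz)

theorem continuous_herglotz_circle {z : ℂ} (hz : ‖z‖ < 1) :
    Continuous fun ξ : Circle => ((ξ : ℂ) + z) / (ξ - z) :=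
  (continuous_subtype_val.add continuous_const).div
    (continuous_subtype_val.sub continuous_const) (sub_ne_zero_of_norm_lt_one hz)

/-- The Schwarz integral formula for a function that is real at the origin. -/
theorem DiffContOnCl.integral_herglotz_re {h : ℂ → ℂ}
    (hh : DiffContOnCl ℂ h (Metric.ball 0 1)) (h0 : (h 0).im = 0) {z : ℂ} (hz : ‖z‖ < 1) :
    ∫ ξ : Circle, ((ξ : ℂ) + z) / (ξ - z) * ((h ξ).re : ℂ) ∂circleMeasure = h z := by
  -- The kernel equals $2\xi/(\xi-z)-1$, so Cauchy's formula and the mean value property suffice.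
  have e1 : ∫ ξ : Circle, ((ξ : ℂ) + z) / (ξ - z) * h ξ ∂circleMeasure = 2 * h z - h 0 := by
    have : ∀ ξ : Circle, ((ξ : ℂ) + z) / (ξ - z) * h ξ
        = 2 * ((ξ : ℂ) / (ξ - z) * h ξ) - h ξ := fun ξ => by
      have := sub_ne_zero_of_norm_lt_one hz ξ
      field_simp
      ring
    simp_rw [this]
    have hc : Continuous fun ξ : Circle => (ξ : ℂ) / (ξ - z) * h ξ :=
      (continuous_subtype_val.div (continuous_subtype_val.sub continuous_const)
        (sub_ne_zero_of_norm_lt_one hz)).mul hh.continuous_circle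
    rw [integral_sub (hc.integrable_circle.const_mul 2) hh.continuous_circle.integrable_circle,
      integral_const_mul, hh.integral_circleMeasure_cauchy hz, hh.integral_circleMeasure]
  have hne : ∀ w ∈ Metric.closedBall (0 : ℂ) 1, 1 - conj z * w ≠ 0 := fun w hw h => by
    have h1 : ‖conj z * w‖ < 1 := by
      rw [norm_mul, Complex.norm_conj]
      have : ‖w‖ ≤ 1 := by simpa using hw
      nlinarith [norm_nonneg z, norm_nonneg w]
    rw [← sub_eq_zero.1 h, norm_one] at h1
    exact lt_irrefl _ h1
  -- On the circle the conjugate of the kernel is $(1+\bar z\xi)/(1-\bar z\xi)$, which is analytic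
  -- in $\xi$ and equals $1$ at the origin. The mean value property applies to its product with $h$.
  have e2 : ∫ ξ : Circle, ((ξ : ℂ) + z) / (ξ - z) * conj (h ξ) ∂circleMeasure = conj (h 0) := by
    have hg : DiffContOnCl ℂ (fun w => (1 + conj z * w) / (1 - conj z * w)) (Metric.ball 0 1) := by
      refine DifferentiableOn.diffContOnCl ?_
      rw [closure_ball (0 : ℂ) one_ne_zero]
      fun_prop (disch := assumption)
    have h3 := (hg.smul hh).integral_circleMeasure
    simp only [smul_eq_mul, mul_zero, add_zero, sub_zero, div_one, one_mul] at h3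
    rw [← h3, ← integral_conj]
    congr 1; ext ξ
    have hξ : conj (ξ : ℂ) = (ξ : ℂ)⁻¹ := by
      rw [← Circle.coe_inv_eq_conj, Circle.coe_inv]
    have hne' := sub_ne_zero_of_norm_lt_one hz ξ
    have hξ0 := Circle.coe_ne_zero ξ
    simp only [map_mul, map_div₀, map_add, map_sub, map_one, Complex.conj_conj, hξ]
    congr 1
    have : (1 : ℂ) - z * (ξ : ℂ)⁻¹ ≠ 0 := by
      intro h; apply hne'; field_simp at h; linear_combination h
    field_simp
  have hint1 : Integrable (fun ξ : Circle => ((ξ : ℂ) + z) / (ξ - z) * h ξ) circleMeasure :=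
    ((continuous_herglotz_circle hz).mul hh.continuous_circle).integrable_circle
  have hint2 : Integrable (fun ξ : Circle => ((ξ : ℂ) + z) / (ξ - z) * conj (h ξ))
      circleMeasure :=
    ((continuous_herglotz_circle hz).mul
      (Complex.continuous_conj.comp hh.continuous_circle)).integrable_circle
  have : ∀ ξ : Circle, ((ξ : ℂ) + z) / (ξ - z) * ((h ξ).re : ℂ)
      = 2⁻¹ * (((ξ : ℂ) + z) / (ξ - z) * h ξ + ((ξ : ℂ) + z) / (ξ - z) * conj (h ξ)) := fun ξ => by
    rw [← mul_add, Complex.add_conj]; push_cast; ring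
  simp_rw [this]
  rw [integral_const_mul, integral_add hint1 hint2, e1, e2, Complex.conj_eq_iff_im.2 h0]
  ring

/-! ### Radial limits of Poisson integrals -/

/-- Lebesgue points on the circle, with respect to closed balls. -/
theorem ae_lebesgue_point_circle {u : Circle → ℂ} (hu : Integrable u circleMeasure) :
    ∀ᵐ η ∂circleMeasure, ∀ ε : ℝ≥0∞, ε ≠ 0 → ε ≠ ∞ → ∀ᶠ r in 𝓝[>] (0 : ℝ),
      ∫⁻ ξ in Metric.closedBall η r, ‖u ξ - u η‖ₑ ∂circleMeasure
        ≤ ε * circleMeasure (Metric.closedBall η r) := by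
  -- The measure is carried to the plane, where Besicovitch coverings give Lebesgue points. Closed
  -- balls centred on the circle pull back to closed balls of the circle.
  set e : Circle → ℂ := fun ξ => (ξ : ℂ) with he
  have hemb : MeasurableEmbedding e :=
    (Continuous.isClosedEmbedding (show Continuous e from continuous_subtype_val)
      Circle.coe_injective).measurableEmbedding
  set μ : Measure ℂ := circleMeasure.map e with hμ
  have : IsFiniteMeasure μ := Measure.isFiniteMeasure_map _ _
  set U : ℂ → ℂ := Function.extend e u 0 with hU
  have hUe : ∀ ξ : Circle, U (e ξ) = u ξ := fun ξ => hemb.injective.extend_apply _ _ _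
  have hUint : Integrable U μ := by
    rw [hμ, hemb.integrable_map_iff]
    exact hu.congr (Eventually.of_forall fun ξ => (hUe ξ).symm)
  have h := (Besicovitch.vitaliFamily μ).ae_tendsto_lintegral_enorm_sub_div_of_integrable hUint
  filter_upwards [hemb.ae_map_iff.1 h] with η hη ε hε hε'
  have h1 := (hη.comp (Besicovitch.tendsto_filterAt μ (e η))).eventually
    (ge_mem_nhds (pos_iff_ne_zero.2 hε))
  filter_upwards [h1] with r hr
  have hpre : e ⁻¹' Metric.closedBall (e η) r = Metric.closedBall η r := by
    ext ξ; rfl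
  simp only [Function.comp, hμ] at hr
  rw [ENNReal.div_le_iff_le_mul (Or.inr hε') (Or.inr hε), hemb.restrict_map,
    hemb.lintegral_map, hemb.map_apply, hpre] at hr
  simpa only [hUe] using hr

theorem MeasureTheory.Integrable.continuous_smul {𝕜 : Type*} [RCLike 𝕜] [NormedSpace 𝕜 ℂ]
    {μ : Measure Circle} {u : Circle → ℂ}
    (hu : Integrable u μ) {P : Circle → 𝕜} (hP : Continuous P) :
    Integrable (fun ξ => P ξ • u ξ) μ :=
  hu.bdd_smul _ hP.aestronglyMeasurable
    (Eventually.of_forall fun ξ => ContinuousMap.norm_coe_le_norm ⟨P, hP⟩ ξ)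

theorem norm_sub_mul_sq_circle (ξ η : Circle) (r : ℝ) :
    ‖(ξ : ℂ) - r * η‖ ^ 2 = (1 - r) ^ 2 + r * dist ξ η ^ 2 := by
  have h : dist ξ η = ‖(ξ : ℂ) - η‖ := by rw [← dist_eq_norm]; rfl
  have h1 : Complex.normSq (ξ : ℂ) = 1 := Circle.normSq_coe ξ
  have h2 : Complex.normSq (η : ℂ) = 1 := Circle.normSq_coe η
  rw [h, ← Complex.normSq_eq_norm_sq, ← Complex.normSq_eq_norm_sq]
  rw [Complex.normSq_apply] at *
  simp only [Complex.normSq_apply, Complex.sub_re, Complex.sub_im, Complex.mul_re, Complex.mul_im,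
    Complex.ofReal_re, Complex.ofReal_im]
  linear_combination (1 - r) * h1 + (r ^ 2 - r) * h2

theorem poissonKernel_radial (ξ η : Circle) {r : ℝ} :
    poissonKernel 0 (r * η) ξ = (1 - r ^ 2) / ((1 - r) ^ 2 + r * dist ξ η ^ 2) := by
  rw [poissonKernel_def, sub_zero, sub_zero, norm_sub_mul_sq_circle, Circle.norm_coe, norm_mul,
    Circle.norm_coe]
  simp

theorem norm_radial_lt_one {r : ℝ} (h0 : 0 ≤ r) (h1 : r < 1) (η : Circle) :
    ‖(r : ℂ) * η‖ < 1 := by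
  rw [norm_mul, Circle.norm_coe, mul_one, Complex.norm_real, Real.norm_of_nonneg h0]
  exact h1

theorem integral_poissonKernel_eq_one {z : ℂ} (hz : ‖z‖ < 1) :
    ∫ ξ : Circle, poissonKernel 0 z ξ ∂circleMeasure = 1 := by
  have h := DiffContOnCl.integral_poissonKernel (f := fun _ => 1) diffContOnCl_const hz
  simp only [Complex.real_smul, mul_one] at h
  rw [integral_complex_ofReal] at h
  exact_mod_cast h

theorem poissonKernel_circle_nonneg {z : ℂ} (hz : ‖z‖ < 1) (ξ : Circle) :
    0 ≤ poissonKernel 0 z ξ := by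
  rw [poissonKernel_def, sub_zero, sub_zero, Circle.norm_coe]
  have := norm_nonneg z
  exact div_nonneg (by nlinarith) (by positivity)

/-- The Poisson integral of an integrable function has radial limits almost everywhere. -/
theorem ae_tendsto_poissonIntegral {u : Circle → ℂ} (hu : Integrable u circleMeasure) :
    ∀ᵐ η : Circle ∂circleMeasure, Tendsto
      (fun r : ℝ => ∫ ξ : Circle, poissonKernel 0 (r * η) ξ • u ξ ∂circleMeasure)
      (𝓝[<] 1) (𝓝 (u η)) := by
  filter_upwards [ae_lebesgue_point_circle hu] with η hη
  set F : Circle → ℝ≥0∞ := fun ξ => ‖u ξ - u η‖ₑ with hF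
  have hFm : AEMeasurable F circleMeasure :=
    (hu.aestronglyMeasurable.sub aestronglyMeasurable_const).enorm
  set ν := circleMeasure.withDensity F with hν
  have hdiff : Integrable (fun ξ => u ξ - u η) circleMeasure := hu.sub (integrable_const _)
  have hνfin : ν Set.univ ≠ ∞ := by
    rw [hν, withDensity_apply _ MeasurableSet.univ, Measure.restrict_univ]
    exact hdiff.2.ne
  -- Layer-cake estimate: the kernel decreases with the distance to `η`, so its nonempty superlevel
  -- sets are balls. Levels above `T`, the kernel's value at distance `δ`, give radii below `δ`,
  -- where the Lebesgue point bound holds. The lower levels cost at most `T` times the total mass of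
  -- `ν`, and `T` tends to $0$ as $r\to1$ with `δ` fixed.
  have key : ∀ ε : ℝ≥0∞, ε ≠ 0 → ε ≠ ∞ → ∃ δ : ℝ, 0 < δ ∧ ∀ r : ℝ, 0 < r → r < 1 →
      ‖(∫ ξ : Circle, poissonKernel 0 (r * η) ξ • u ξ ∂circleMeasure) - u η‖ₑ
        ≤ ε + ENNReal.ofReal ((1 - r ^ 2) / ((1 - r) ^ 2 + r * δ ^ 2)) * ν Set.univ := by
    intro ε hε hε'
    obtain ⟨δ, hδ, hball⟩ := mem_nhdsGT_iff_exists_Ioo_subset.1 (hη ε hε hε')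
    refine ⟨δ, hδ, fun r hr0 hr1 => ?_⟩
    have hball' : ∀ R : ℝ, R < δ → ν (Metric.closedBall η R)
        ≤ ε * circleMeasure (Metric.closedBall η R) := by
      intro R hR
      rw [hν, withDensity_apply _ Metric.isClosed_closedBall.measurableSet]
      rcases lt_trichotomy R 0 with h | rfl | h
      · rw [Metric.closedBall_eq_empty.2 h]; simp
      · rw [Metric.closedBall_zero, lintegral_singleton]; simp [hF]
      · exact hball ⟨h, hR⟩
    have hz := norm_radial_lt_one hr0.le hr1 η
    set P : Circle → ℝ := fun ξ => poissonKernel 0 (r * η) ξ with hP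
    have hPc : Continuous P := continuous_poissonKernel_circle hz
    have hP0 : ∀ ξ, 0 ≤ P ξ := poissonKernel_circle_nonneg hz
    set T : ℝ := (1 - r ^ 2) / ((1 - r) ^ 2 + r * δ ^ 2) with hT
    have hlevel : ∀ t : ℝ, 0 < t → ν {ξ | t ≤ P ξ} ≤ ε * circleMeasure {ξ | t ≤ P ξ}
        + (Set.Ioc 0 T).indicator (fun _ => ν Set.univ) t := by
      intro t ht
      by_cases htT : t ≤ T
      · rw [Set.indicator_of_mem (show t ∈ Set.Ioc 0 T from ⟨ht, htT⟩)]
        exact (measure_mono (Set.subset_univ _)).trans le_add_self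
      · refine le_add_right ?_
        push Not at htT
        -- The inequality `t ≤ P ξ` solved for the squared distance.
        set q : ℝ := ((1 - r ^ 2) / t - (1 - r) ^ 2) / r with hq
        have hiff : ∀ ξ, t ≤ P ξ ↔ dist ξ η ^ 2 ≤ q := by
          intro ξ
          have hd : 0 < (1 - r) ^ 2 + r * dist ξ η ^ 2 := by
            have : 0 < (1 - r) ^ 2 := by nlinarith
            positivity
          rw [hP]
          simp only
          rw [poissonKernel_radial, le_div_iff₀ hd, hq, le_div_iff₀ hr0, le_sub_iff_add_le (b := (1 - r) ^ 2),
            le_div_iff₀ ht]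
          constructor <;> intro h <;> nlinarith
        by_cases hq0 : q < 0
        · have : {ξ | t ≤ P ξ} = ∅ := by
            ext ξ
            simp only [Set.mem_ofPred_eq, Set.mem_empty_iff_false, iff_false, hiff]
            nlinarith [sq_nonneg (dist ξ η)]
          rw [this]; simp
        · push Not at hq0
          have : {ξ | t ≤ P ξ} = Metric.closedBall η (Real.sqrt q) := by
            ext ξ
            rw [Set.mem_ofPred_eq, hiff, Metric.mem_closedBall, Real.le_sqrt dist_nonneg hq0]
          rw [this]
          refine hball' _ ?_
          rw [Real.sqrt_lt' hδ, hq, div_lt_iff₀ hr0, sub_lt_iff_lt_add, div_lt_iff₀ ht]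
          rw [hT, div_lt_iff₀ (by have : 0 < (1 - r) ^ 2 := by nlinarith
                                  positivity)] at htT
          nlinarith
    have e1 : ∫ ξ : Circle, P ξ • u ξ ∂circleMeasure - u η
        = ∫ ξ : Circle, P ξ • (u ξ - u η) ∂circleMeasure := by
      have hi1 : Integrable (fun ξ => P ξ • u ξ) circleMeasure :=
        hu.continuous_smul hPc
      simp_rw [smul_sub]
      rw [integral_sub hi1 (hPc.integrable_circle.smul_const _), integral_smul_const,
        integral_poissonKernel_eq_one hz, one_smul]
    have e2 : ∫⁻ ξ, ENNReal.ofReal (P ξ) ∂circleMeasure = 1 := by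
      rw [← ofReal_integral_eq_lintegral_ofReal hPc.integrable_circle
        (Eventually.of_forall hP0), integral_poissonKernel_eq_one hz, ENNReal.ofReal_one]
    rw [e1]
    calc ‖∫ ξ : Circle, P ξ • (u ξ - u η) ∂circleMeasure‖ₑ
        ≤ ∫⁻ ξ, ‖P ξ • (u ξ - u η)‖ₑ ∂circleMeasure := enorm_integral_le_lintegral_enorm _
      _ = ∫⁻ ξ, (F * fun ξ => ENNReal.ofReal (P ξ)) ξ ∂circleMeasure := by
          refine lintegral_congr fun ξ => ?_
          rw [enorm_smul, Real.enorm_of_nonneg (hP0 ξ), mul_comm]; rfl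
      _ = ∫⁻ ξ, ENNReal.ofReal (P ξ) ∂ν :=
          (lintegral_withDensity_eq_lintegral_mul₀ hFm
            hPc.measurable.ennreal_ofReal.aemeasurable).symm
      _ = ∫⁻ t in Set.Ioi 0, ν {ξ | t ≤ P ξ} :=
          lintegral_eq_lintegral_meas_le ν (Eventually.of_forall hP0) hPc.aemeasurable
      _ ≤ ∫⁻ t in Set.Ioi 0, (ε * circleMeasure {ξ | t ≤ P ξ}
            + (Set.Ioc 0 T).indicator (fun _ => ν Set.univ) t) :=
          setLIntegral_mono' measurableSet_Ioi fun t ht => hlevel t ht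
      _ ≤ ε + ENNReal.ofReal T * ν Set.univ := by
          rw [lintegral_add_right _ (measurable_const.indicator measurableSet_Ioc),
            lintegral_const_mul' _ _ hε',
            ← lintegral_eq_lintegral_meas_le circleMeasure (Eventually.of_forall hP0)
              hPc.aemeasurable, e2, mul_one, lintegral_indicator_const measurableSet_Ioc]
          rw [mul_comm (ν Set.univ)]
          refine add_le_add_right (mul_le_mul_left ?_ _) _
          refine (Measure.restrict_apply_le _ _).trans ?_
          simp
  rw [tendsto_iff_edist_tendsto_0]
  rw [ENNReal.tendsto_nhds_zero]
  intro ε hε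
  by_cases hεt : ε = ∞
  · simp [hεt]
  have hε2 : ε / 2 ≠ 0 := by simpa using hε.ne'
  obtain ⟨δ, hδ, hk⟩ := key (ε / 2) hε2 (ENNReal.div_ne_top hεt two_ne_zero)
  have hlim : Tendsto (fun r : ℝ => ENNReal.ofReal ((1 - r ^ 2) / ((1 - r) ^ 2 + r * δ ^ 2))
      * ν Set.univ) (𝓝[<] 1) (𝓝 0) := by
    have h1 : ContinuousAt (fun r : ℝ => (1 - r ^ 2) / ((1 - r) ^ 2 + r * δ ^ 2)) 1 := by
      refine ContinuousAt.div (by fun_prop) (by fun_prop) ?_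
      simp [hδ.ne']
    have h2 := (ENNReal.tendsto_ofReal (h1.tendsto.mono_left (nhdsWithin_le_nhds (s := Set.Iio 1))))
    have h3 := ENNReal.Tendsto.mul_const h2 (Or.inr hνfin)
    simpa using h3
  have hr : ∀ᶠ r : ℝ in 𝓝[<] 1, r ∈ Set.Ioo (0 : ℝ) 1 := Ioo_mem_nhdsLT one_pos
  filter_upwards [hlim.eventually (ge_mem_nhds (pos_iff_ne_zero.2 hε2)), hr] with r h1 h2
  rw [edist_eq_enorm_sub]
  calc _ ≤ _ := hk r h2.1 h2.2
    _ ≤ ε / 2 + ε / 2 := by gcongr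
    _ = ε := ENNReal.add_halves ε

/-! ### Orthogonal polynomials: recursion, zeros -/

theorem continuous_eval_circle (P : ℂ[X]) : Continuous fun ξ : Circle => P.eval (ξ : ℂ) :=
  P.continuous.comp continuous_subtype_val

theorem Circle.conj_coe (ξ : Circle) : conj (ξ : ℂ) = (ξ : ℂ)⁻¹ := by
  rw [← Circle.coe_inv_eq_conj, Circle.coe_inv]

theorem Polynomial.eq_of_eval_circle_eq {P Q : ℂ[X]}
    (h : ∀ ξ : Circle, P.eval (ξ : ℂ) = Q.eval (ξ : ℂ)) : P = Q := by
  have : Infinite (Set.Ioc (-Real.pi) Real.pi) :=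
    Set.Ioc_infinite (neg_lt_self Real.pi_pos) |>.to_subtype
  have : Infinite Circle := Infinite.of_injective _ Circle.argEquiv.symm.injective
  have hinf : (Set.range fun ξ : Circle => (ξ : ℂ)).Infinite :=
    Set.infinite_range_of_injective Circle.coe_injective
  refine eq_of_infinite_eval_eq P Q (hinf.mono ?_)
  rintro _ ⟨ξ, rfl⟩
  exact h ξ

theorem eval_starPoly {n : ℕ} {Q : ℂ[X]} (hQ : Q.natDegree ≤ n) {z : ℂ} (hz : z ≠ 0) :
    (starPoly n Q).eval z = z ^ n * conj (Q.eval (conj z)⁻¹) := by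
  have hi : z⁻¹ ≠ 0 := inv_ne_zero hz
  let _ : Invertible z⁻¹ := invertibleOfNonzero hi
  have h := eval₂_reflect_mul_pow (RingHom.id ℂ) z⁻¹ n (Q.map (starRingEnd ℂ))
    ((natDegree_map_le).trans hQ)
  rw [invOf_eq_inv, inv_inv] at h
  have h2 : eval z⁻¹ (Q.map (starRingEnd ℂ)) = conj (Q.eval (conj z)⁻¹) := by
    rw [← Complex.conj_conj z⁻¹, eval_map_apply, map_inv₀]
  change eval z (starPoly n Q) * z⁻¹ ^ n = eval z⁻¹ (Q.map (starRingEnd ℂ)) at h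
  rw [h2] at h
  rw [← h, inv_pow]
  field_simp

theorem eval_starPoly_circle {n : ℕ} {Q : ℂ[X]} (hQ : Q.natDegree ≤ n) (ξ : Circle) :
    (starPoly n Q).eval (ξ : ℂ) = (ξ : ℂ) ^ n * conj (Q.eval (ξ : ℂ)) := by
  rw [eval_starPoly hQ (Circle.coe_ne_zero ξ), Circle.conj_coe, inv_inv]

theorem natDegree_starPoly_le {n : ℕ} {Q : ℂ[X]} (hQ : Q.natDegree ≤ n) :
    (starPoly n Q).natDegree ≤ n :=
  natDegree_reflect_le.trans (max_le le_rfl (natDegree_map_le.trans hQ))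

theorem eval_zero_starPoly (n : ℕ) (Q : ℂ[X]) : (starPoly n Q).eval 0 = conj (Q.coeff n) := by
  rw [← coeff_zero_eq_eval_zero, starPoly, coeff_reflect, revAt_zero, coeff_map]

section PolyInner

variable (μ : Measure Circle) [IsFiniteMeasure μ]

theorem integrable_eval_mul_conj_eval (P Q : ℂ[X]) :
    Integrable (fun ξ : Circle => P.eval (ξ : ℂ) * conj (Q.eval (ξ : ℂ))) μ :=
  ((continuous_eval_circle P).mul
    (Complex.continuous_conj.comp (continuous_eval_circle Q))).integrable_circle

theorem polyInner_add (P Q R : ℂ[X]) :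
    polyInner μ (P + Q) R = polyInner μ P R + polyInner μ Q R := by
  rw [polyInner, polyInner, polyInner,
    ← integral_add (integrable_eval_mul_conj_eval μ P R) (integrable_eval_mul_conj_eval μ Q R)]
  congr 1; ext ξ
  simp [add_mul]

omit [IsFiniteMeasure μ] in
theorem polyInner_C_mul (c : ℂ) (P R : ℂ[X]) :
    polyInner μ (C c * P) R = c * polyInner μ P R := by
  rw [polyInner, polyInner, ← integral_const_mul]
  congr 1; ext ξ
  simp [mul_assoc]

omit [IsFiniteMeasure μ] in
theorem polyInner_X_mul (P R : ℂ[X]) : polyInner μ (X * P) (X * R) = polyInner μ P R := by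
  rw [polyInner, polyInner]
  congr 1; ext ξ
  have := Circle.coe_ne_zero ξ
  simp only [eval_mul, eval_X, map_mul, Circle.conj_coe]
  field_simp

omit [IsFiniteMeasure μ] in
-- On the circle reversal is conjugation followed by multiplication by $\xi^n$. Orthogonality
-- relations thus pass between $Q$ and $Q^*$ with $j$ and $n-j$ exchanged.
theorem polyInner_starPoly_X_pow {n j : ℕ} (hj : j ≤ n) {Q : ℂ[X]} (hQ : Q.natDegree ≤ n) :
    polyInner μ (starPoly n Q) (X ^ j) = conj (polyInner μ Q (X ^ (n - j))) := by
  rw [polyInner_conj, polyInner, polyInner]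
  congr 1; ext ξ
  have := Circle.coe_ne_zero ξ
  rw [eval_starPoly_circle hQ, eval_pow, eval_X, eval_pow, eval_X, map_pow, Circle.conj_coe,
    pow_sub₀ _ this hj]
  ring

omit [IsFiniteMeasure μ] in
theorem polyInner_self_eq (P : ℂ[X]) :
    polyInner μ P P = ((∫ ξ : Circle, ‖P.eval (ξ : ℂ)‖ ^ 2 ∂μ : ℝ) : ℂ) := by
  rw [polyInner, ← integral_complex_ofReal]
  congr 1; ext ξ
  rw [Complex.mul_conj, Complex.normSq_eq_norm_sq]

end PolyInner

section Szego

variable (σ : Measure Circle) [IsProbabilityMeasure σ] (hσ : σ.support.Infinite)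

include hσ

theorem natDegree_monicOPUC (n : ℕ) : (monicOPUC σ n).natDegree = n :=
  (monicOPUC_spec σ hσ n).2.1

theorem polyInner_monicOPUC_X_pow {n j : ℕ} (hj : j < n) :
    polyInner σ (monicOPUC σ n) (X ^ j) = 0 :=
  (monicOPUC_spec σ hσ n).2.2 j hj

theorem polyInner_monicOPUC_of_natDegree_lt {n : ℕ} {P : ℂ[X]} (hP : P.natDegree < n) :
    polyInner σ (monicOPUC σ n) P = 0 := by
  rw [← polyInner_conj,
    polyInner_eq_zero_of_natDegree_lt σ (fun j hj => polyInner_monicOPUC_X_pow σ hσ hj) hP,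
    map_zero]

/-- Szegő's recursion. -/
theorem monicOPUC_succ (n : ℕ) : monicOPUC σ (n + 1) =
    X * monicOPUC σ n - C (conj (schurParam σ n)) * starPoly n (monicOPUC σ n) := by
  set c := conj (schurParam σ n) with hc
  set Φ := monicOPUC σ n with hΦ
  have hd : Φ.natDegree = n := natDegree_monicOPUC σ hσ n
  have hm : Φ.Monic := (monicOPUC_spec σ hσ n).1
  -- The error in the recursion. Its constant term vanishes by the choice of the Schur parameter,
  -- and its degree is at most $n$ because the leading terms cancel, so it is $zR$ with $\deg R<n$
  -- unless it is zero. It is orthogonal to $z,\dots,z^n$, hence $R$ is orthogonal to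
  -- $1,\dots,z^{n-1}$ and so to itself.
  set Q := monicOPUC σ (n + 1) + (C (-1) * (X * Φ) + C c * starPoly n Φ) with hQ
  have hQ0 : Q.coeff 0 = 0 := by
    rw [coeff_zero_eq_eval_zero, hQ, hc]
    simp [eval_zero_starPoly, schurParam]
    rw [← hd]
    simp [hm.coeff_natDegree]
  have hQX : Q = X * Q.divX := by
    conv_lhs => rw [← divX_mul_X_add Q, hQ0]
    simp [mul_comm]
  have hQd : Q.degree < ((n + 1 : ℕ) : WithBot ℕ) := by
    have h1 : (monicOPUC σ (n + 1) + C (-1) * (X * Φ)).degree < ((n + 1 : ℕ) : WithBot ℕ) := by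
      have e : monicOPUC σ (n + 1) + C (-1) * (X * Φ) = monicOPUC σ (n + 1) - X * Φ := by
        simp [sub_eq_add_neg]
      have hmX := monic_X.mul hm
      have hXd : (X * Φ).degree = ((n + 1 : ℕ) : WithBot ℕ) := by
        rw [degree_eq_natDegree hmX.ne_zero, monic_X.natDegree_mul hm, hd, natDegree_X, add_comm]
      have hΦd : (monicOPUC σ (n + 1)).degree = ((n + 1 : ℕ) : WithBot ℕ) := by
        rw [degree_eq_natDegree (monicOPUC_spec σ hσ (n + 1)).1.ne_zero,
          natDegree_monicOPUC σ hσ]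
      rw [e, ← hΦd]
      exact degree_sub_lt_left (hΦd.trans hXd.symm) (monicOPUC_spec σ hσ (n + 1)).1.ne_zero
        ((monicOPUC_spec σ hσ (n + 1)).1.leadingCoeff.trans hmX.leadingCoeff.symm)
    rw [hQ, ← add_assoc]
    refine (degree_add_le _ _).trans_lt (max_lt h1 ?_)
    rw [← smul_eq_C_mul]
    refine (degree_smul_le _ _).trans_lt (degree_le_natDegree.trans_lt ?_)
    exact_mod_cast Nat.lt_succ_of_le (natDegree_starPoly_le hd.le)
  have horth : ∀ j < n, polyInner σ Q.divX (X ^ j) = 0 := by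
    intro j hj
    rw [← polyInner_X_mul, ← hQX, ← pow_succ', hQ, polyInner_add, polyInner_add,
      polyInner_C_mul, polyInner_C_mul, pow_succ', polyInner_X_mul, ← pow_succ',
      polyInner_monicOPUC_X_pow σ hσ (Nat.succ_lt_succ hj),
      polyInner_monicOPUC_X_pow σ hσ hj, polyInner_starPoly_X_pow σ hj hd.le,
      polyInner_monicOPUC_X_pow σ hσ (by omega)]
    simp
  have hzero : Q.divX = 0 := by
    by_contra hne
    have hQne : Q ≠ 0 := fun h => hne (by rw [h, divX_zero])
    refine polyInner_self_ne_zero σ hσ hne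
      (polyInner_eq_zero_of_natDegree_lt σ horth ?_)
    have h1 : Q.natDegree < n + 1 := (natDegree_lt_iff_degree_lt hQne).2 hQd
    have h2 : Q.natDegree = Q.divX.natDegree + 1 := by
      conv_lhs => rw [hQX]
      rw [natDegree_X_mul hne]
    omega
  rw [hzero, mul_zero] at hQX
  have : monicOPUC σ (n + 1) = Q + (X * Φ - C c * starPoly n Φ) := by
    rw [hQ, C_neg, C_1]; ring
  rw [this, hQX, zero_add]

theorem starPoly_monicOPUC_succ (n : ℕ) : starPoly (n + 1) (monicOPUC σ (n + 1)) =
    starPoly n (monicOPUC σ n) - C (schurParam σ n) * (X * monicOPUC σ n) := by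
  refine Polynomial.eq_of_eval_circle_eq fun ξ => ?_
  have hξ := Circle.coe_ne_zero ξ
  rw [eval_starPoly_circle (natDegree_monicOPUC σ hσ _).le, monicOPUC_succ σ hσ]
  simp only [eval_sub, eval_mul, eval_C, eval_X,
    eval_starPoly_circle (natDegree_monicOPUC σ hσ n).le, map_sub, map_mul, map_pow,
    Complex.conj_conj, Circle.conj_coe, inv_pow]
  field_simp
  ring

theorem integral_norm_sq_monicOPUC_pos (n : ℕ) :
    0 < ∫ ξ : Circle, ‖(monicOPUC σ n).eval (ξ : ℂ)‖ ^ 2 ∂σ := by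
  have h := polyInner_self_ne_zero σ hσ (monicOPUC_spec σ hσ n).1.ne_zero
  rw [polyInner_self_eq] at h
  have h' : (∫ ξ : Circle, ‖(monicOPUC σ n).eval (ξ : ℂ)‖ ^ 2 ∂σ) ≠ 0 := by exact_mod_cast h
  exact lt_of_le_of_ne (integral_nonneg fun _ => by positivity) h'.symm

/-- The Pythagorean identity for the orthogonal polynomials. -/
theorem integral_norm_sq_monicOPUC_add (n : ℕ) {P : ℂ[X]} (hP : P.natDegree < n) (c : ℂ) :
    ∫ ξ : Circle, ‖(monicOPUC σ n + C c * P).eval (ξ : ℂ)‖ ^ 2 ∂σ =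
      (∫ ξ : Circle, ‖(monicOPUC σ n).eval (ξ : ℂ)‖ ^ 2 ∂σ) +
        ‖c‖ ^ 2 * ∫ ξ : Circle, ‖P.eval (ξ : ℂ)‖ ^ 2 ∂σ := by
  have h0 := polyInner_monicOPUC_of_natDegree_lt σ hσ hP
  have h1 : polyInner σ P (monicOPUC σ n) = 0 := by rw [← polyInner_conj, h0, map_zero]
  have h2 : polyInner σ (monicOPUC σ n + C c * P) (monicOPUC σ n + C c * P)
      = polyInner σ (monicOPUC σ n) (monicOPUC σ n) + c * conj c * polyInner σ P P := by
    have hsw : ∀ R : ℂ[X], polyInner σ R (monicOPUC σ n + C c * P)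
        = polyInner σ R (monicOPUC σ n) + conj c * polyInner σ R P := fun R => by
      rw [← polyInner_conj, polyInner_add, polyInner_C_mul, map_add, map_mul, polyInner_conj,
        polyInner_conj]
    rw [polyInner_add, polyInner_C_mul, hsw, hsw, h0, h1]
    ring
  rw [polyInner_self_eq, polyInner_self_eq, polyInner_self_eq, Complex.mul_conj,
    Complex.normSq_eq_norm_sq] at h2
  exact_mod_cast h2

/-- Pythagoras for $z\Phi_n=\Phi_{n+1}+\bar\gamma_n\Phi_n^*$, since $|z\Phi_n|=|\Phi_n^*|=|\Phi_n|$
on the circle. -/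
theorem integral_norm_sq_monicOPUC_succ (n : ℕ) :
    ∫ ξ : Circle, ‖(monicOPUC σ (n + 1)).eval (ξ : ℂ)‖ ^ 2 ∂σ =
      (1 - ‖schurParam σ n‖ ^ 2) * ∫ ξ : Circle, ‖(monicOPUC σ n).eval (ξ : ℂ)‖ ^ 2 ∂σ := by
  have hd := (natDegree_monicOPUC σ hσ n).le
  have h := integral_norm_sq_monicOPUC_add σ hσ (n + 1)
    (Nat.lt_succ_of_le (natDegree_starPoly_le hd)) (conj (schurParam σ n))
  have e : monicOPUC σ (n + 1) + C (conj (schurParam σ n)) * starPoly n (monicOPUC σ n)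
      = X * monicOPUC σ n := by rw [monicOPUC_succ σ hσ]; ring
  rw [e] at h
  simp only [eval_mul, eval_X, norm_mul, Circle.norm_coe, one_mul, Complex.norm_conj,
    eval_starPoly_circle hd, norm_pow, one_pow] at h
  linarith

/-- If $\Phi_n=(z-a)p$, then $zp=\Phi_n+ap$, and Pythagoras gives $(1-|a|^2)\|p\|^2=\|\Phi_n\|^2>0$.
-/
theorem norm_lt_one_of_isRoot_monicOPUC {n : ℕ} {a : ℂ} (ha : (monicOPUC σ n).IsRoot a) :
    ‖a‖ < 1 := by
  obtain ⟨p, hp⟩ := dvd_iff_isRoot.2 ha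
  have hm := (monicOPUC_spec σ hσ n).1
  have hp0 : p ≠ 0 := by rintro rfl; rw [mul_zero] at hp; exact hm.ne_zero hp
  have hdeg : p.natDegree < n := by
    have := natDegree_monicOPUC σ hσ n
    rw [hp, natDegree_mul (X_sub_C_ne_zero a) hp0, natDegree_X_sub_C] at this
    omega
  have h := integral_norm_sq_monicOPUC_add σ hσ n hdeg a
  have e : monicOPUC σ n + C a * p = X * p := by rw [hp]; ring
  rw [e] at h
  simp only [eval_mul, eval_X, norm_mul, Circle.norm_coe, one_mul] at h
  have hpos := integral_norm_sq_monicOPUC_pos σ hσ n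
  have hnn : 0 ≤ ∫ ξ : Circle, ‖p.eval (ξ : ℂ)‖ ^ 2 ∂σ := integral_nonneg fun _ => by positivity
  by_contra hlt
  push Not at hlt
  nlinarith [mul_nonneg hnn (by nlinarith : 0 ≤ ‖a‖ ^ 2 - 1)]

theorem eval_starPoly_monicOPUC_eq_prod (n : ℕ) (z : ℂ) :
    (starPoly n (monicOPUC σ n)).eval z
      = ((monicOPUC σ n).roots.map fun a => 1 - conj a * z).prod := by
  have hm := (monicOPUC_spec σ hσ n).1
  have hd := natDegree_monicOPUC σ hσ n
  rcases eq_or_ne z 0 with rfl | hz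
  · rw [eval_zero_starPoly]
    nth_rw 2 [← hd]
    simp [hm.coeff_natDegree]
  · have hs := IsAlgClosed.splits (monicOPUC σ n)
    have hcard : (monicOPUC σ n).roots.card = n := by
      rw [← hs.natDegree_eq_card_roots, hd]
    rw [eval_starPoly hd.le hz, hs.eval_eq_prod_roots_of_monic hm, map_multiset_prod,
      Multiset.map_map]
    nth_rw 1 [← hcard]
    rw [← Multiset.prod_replicate, ← Multiset.map_const', ← Multiset.prod_map_mul]
    congr 1
    refine Multiset.map_congr rfl fun a _ => ?_
    simp only [Function.comp, map_sub, map_inv₀, Complex.conj_conj]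
    field_simp

/-- The factors $1-\bar a z$ with $|a|<1$ have positive real part on the closed disc, so their
principal logarithms can be added. -/
theorem exists_log_starPoly_monicOPUC (n : ℕ) :
    ∃ h : ℂ → ℂ, DiffContOnCl ℂ h (Metric.ball 0 1) ∧ h 0 = 0 ∧
      ∀ z, ‖z‖ ≤ 1 → Complex.exp (h z) = (starPoly n (monicOPUC σ n)).eval z := by
  have hre : ∀ a ∈ (monicOPUC σ n).roots, ∀ z : ℂ, ‖z‖ ≤ 1 → 0 < (1 - conj a * z).re := by
    intro a ha z hz
    have h1 := norm_lt_one_of_isRoot_monicOPUC σ hσ (isRoot_of_mem_roots ha)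
    have h2 := Complex.re_le_norm (conj a * z)
    rw [norm_mul, Complex.norm_conj] at h2
    rw [Complex.sub_re, Complex.one_re]
    nlinarith [norm_nonneg a, norm_nonneg z]
  refine ⟨fun z => ((monicOPUC σ n).roots.map fun a => Complex.log (1 - conj a * z)).sum,
    ?_, ?_, fun z hz => ?_⟩
  · refine DifferentiableOn.diffContOnCl ?_
    rw [closure_ball (0 : ℂ) one_ne_zero]
    generalize (monicOPUC σ n).roots = s at hre
    induction s using Multiset.induction_on with
    | empty => simp
    | cons a s ih =>
      simp only [Multiset.map_cons, Multiset.sum_cons]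
      refine DifferentiableOn.fun_add ?_ (ih fun b hb => hre b (Multiset.mem_cons_of_mem hb))
      refine DifferentiableOn.clog (by fun_prop) fun z hz => Or.inl ?_
      exact hre a (Multiset.mem_cons_self a s) z (by simpa using hz)
  · simp
  · rw [eval_starPoly_monicOPUC_eq_prod σ hσ, Complex.exp_multiset_sum, Multiset.map_map]
    congr 1
    refine Multiset.map_congr rfl fun a ha => Complex.exp_log fun h0 => ?_
    have := hre a ha z hz
    rw [h0] at this
    exact lt_irrefl _ this

end Szego

/-! ### The Bernstein–Szegő approximation -/

/-- `polyInner μ` as a linear functional of its first argument. -/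
noncomputable def polyInnerLeft (μ : Measure Circle) [IsFiniteMeasure μ] (R : ℂ[X]) :
    ℂ[X] →ₗ[ℂ] ℂ where
  toFun P := polyInner μ P R
  map_add' P Q := polyInner_add μ P Q R
  map_smul' c P := by rw [smul_eq_C_mul, polyInner_C_mul]; rfl

theorem polyInner_eq_sum (μ : Measure Circle) [IsFiniteMeasure μ] (P R : ℂ[X]) :
    polyInner μ P R = ∑ i ∈ Finset.range (P.natDegree + 1), P.coeff i * polyInner μ (X ^ i) R := by
  change polyInnerLeft μ R P = _
  conv_lhs => rw [P.as_sum_range_C_mul_X_pow]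
  rw [map_sum]
  refine Finset.sum_congr rfl fun i _ => ?_
  rw [← smul_eq_C_mul, map_smul]; rfl

theorem starPoly_C_mul (n : ℕ) (c : ℂ) (Q : ℂ[X]) :
    starPoly n (C c * Q) = C (conj c) * starPoly n Q := by
  rw [starPoly, Polynomial.map_mul, map_C, reflect_C_mul]; rfl

section BernsteinSzego

variable (σ : Measure Circle)

/-- The squared norm `‖Φ_n‖²` in `L²(σ)`. -/
noncomputable def monicNormSq (n : ℕ) : ℝ := ∫ ξ : Circle, ‖(monicOPUC σ n).eval (ξ : ℂ)‖ ^ 2 ∂σ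

theorem eval_starPoly_orthonormalOPUC (n : ℕ) (z : ℂ) :
    (starPoly n (orthonormalOPUC σ n)).eval z
      = ((Real.sqrt (monicNormSq σ n) : ℝ) : ℂ)⁻¹ * (starPoly n (monicOPUC σ n)).eval z := by
  rw [orthonormalOPUC, starPoly_C_mul, eval_mul, eval_C, map_inv₀, Complex.conj_ofReal]
  rfl

variable [IsProbabilityMeasure σ] (hσ : σ.support.Infinite)

include hσ

theorem monicNormSq_pos (n : ℕ) : 0 < monicNormSq σ n := integral_norm_sq_monicOPUC_pos σ hσ n

/-- The reversed orthonormal polynomials have an analytic logarithm on the closed disc. -/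
theorem exists_log_starPoly_orthonormalOPUC (n : ℕ) :
    ∃ h : ℂ → ℂ, DiffContOnCl ℂ h (Metric.ball 0 1) ∧ (h 0).im = 0 ∧
      ∀ z, ‖z‖ ≤ 1 → Complex.exp (h z) = (starPoly n (orthonormalOPUC σ n)).eval z := by
  obtain ⟨h, h1, h2, h3⟩ := exists_log_starPoly_monicOPUC σ hσ n
  have hpos : 0 < Real.sqrt (monicNormSq σ n) := Real.sqrt_pos.2 (monicNormSq_pos σ hσ n)
  refine ⟨fun z => ((-Real.log (Real.sqrt (monicNormSq σ n)) : ℝ) : ℂ) + h z, h1.const_add _,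
    ?_, fun z hz => ?_⟩
  · simp [h2, -Complex.ofReal_neg, Complex.ofReal_im]
  · rw [Complex.exp_add, h3 z hz, eval_starPoly_orthonormalOPUC, ← Complex.ofReal_exp,
      Real.exp_neg, Real.exp_log hpos, Complex.ofReal_inv]

theorem eval_starPoly_orthonormalOPUC_ne_zero (n : ℕ) (ξ : Circle) :
    (starPoly n (orthonormalOPUC σ n)).eval (ξ : ℂ) ≠ 0 := by
  obtain ⟨h, -, -, h3⟩ := exists_log_starPoly_orthonormalOPUC σ hσ n
  rw [← h3 ξ (Circle.norm_coe ξ).le]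
  exact Complex.exp_ne_zero _

theorem norm_sq_eval_starPoly_orthonormalOPUC (n : ℕ) (ξ : Circle) :
    ‖(starPoly n (orthonormalOPUC σ n)).eval (ξ : ℂ)‖ ^ 2
      = (monicNormSq σ n)⁻¹ * ‖(monicOPUC σ n).eval (ξ : ℂ)‖ ^ 2 := by
  rw [eval_starPoly_orthonormalOPUC, eval_starPoly_circle (natDegree_monicOPUC σ hσ n).le,
    norm_mul, norm_mul, norm_pow, Circle.norm_coe, one_pow, one_mul, Complex.norm_conj, norm_inv,
    Complex.norm_real, Real.norm_of_nonneg (Real.sqrt_nonneg _), mul_pow, inv_pow,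
    Real.sq_sqrt (monicNormSq_pos σ hσ n).le]

theorem integral_norm_sq_starPoly_orthonormalOPUC (n : ℕ) :
    ∫ ξ : Circle, ‖(starPoly n (orthonormalOPUC σ n)).eval (ξ : ℂ)‖ ^ 2 ∂σ = 1 := by
  simp_rw [norm_sq_eval_starPoly_orthonormalOPUC σ hσ]
  rw [integral_const_mul]
  exact inv_mul_cancel₀ (monicNormSq_pos σ hσ n).ne'

omit hσ [IsProbabilityMeasure σ] in
/-- The Bernstein–Szegő measure `|φ_n|⁻² dm`. -/
noncomputable def bernsteinSzego (n : ℕ) : Measure Circle :=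
  circleMeasure.withDensity fun ξ =>
    ENNReal.ofReal (‖(starPoly n (orthonormalOPUC σ n)).eval (ξ : ℂ)‖ ^ 2)⁻¹

theorem continuous_bernsteinSzego_density (n : ℕ) : Continuous fun ξ : Circle =>
    (‖(starPoly n (orthonormalOPUC σ n)).eval (ξ : ℂ)‖ ^ 2)⁻¹ :=
  ((continuous_eval_circle _).norm.pow 2).inv₀ fun ξ =>
    pow_ne_zero _ (norm_ne_zero_iff.2 (eval_starPoly_orthonormalOPUC_ne_zero σ hσ n ξ))

theorem isFiniteMeasure_bernsteinSzego (n : ℕ) : IsFiniteMeasure (bernsteinSzego σ n) :=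
  isFiniteMeasure_withDensity_ofReal
    (continuous_bernsteinSzego_density σ hσ n).integrable_circle.2

theorem integral_bernsteinSzego {E : Type*} [NormedAddCommGroup E] [NormedSpace ℝ E] (n : ℕ)
    (g : Circle → E) : ∫ ξ, g ξ ∂bernsteinSzego σ n =
      ∫ ξ : Circle, (‖(starPoly n (orthonormalOPUC σ n)).eval (ξ : ℂ)‖ ^ 2)⁻¹ • g ξ
        ∂circleMeasure := by
  rw [bernsteinSzego, integral_withDensity_eq_integral_toReal_smul
    (continuous_bernsteinSzego_density σ hσ n).measurable.ennreal_ofReal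
    (Eventually.of_forall fun _ => ENNReal.ofReal_lt_top)]
  congr 1; ext ξ
  rw [ENNReal.toReal_ofReal (by positivity)]

/-- On the circle $\Phi_n\bar\xi^j|\phi_n^*|^{-2}=\|\Phi_n\|^2\,\xi^{n-j}/\Phi_n^*$. The right side
is analytic in the disc, where $\Phi_n^*$ has no zeros, and vanishes at the origin. -/
theorem polyInner_bernsteinSzego_monicOPUC {n j : ℕ} (hj : j < n) :
    polyInner (bernsteinSzego σ n) (monicOPUC σ n) (X ^ j) = 0 := by
  obtain ⟨h, h1, -, h3⟩ := exists_log_starPoly_monicOPUC σ hσ n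
  rw [polyInner, integral_bernsteinSzego σ hσ]
  have hd : DiffContOnCl ℂ (fun z => z ^ (n - j) * ((monicNormSq σ n : ℂ) * Complex.exp (-h z)))
      (Metric.ball 0 1) :=
    ((differentiable_id.pow (n - j)).diffContOnCl).smul
      (((Complex.differentiable_exp.diffContOnCl (s := Set.univ)).comp h1.neg
        (Set.mapsTo_univ _ _)).const_smul (monicNormSq σ n : ℂ))
  have h4 := hd.integral_circleMeasure
  rw [zero_pow (by omega), zero_mul] at h4
  rw [← h4]
  congr 1; ext ξ
  have hξ := Circle.coe_ne_zero ξ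
  have hN : (monicNormSq σ n : ℂ) ≠ 0 := by exact_mod_cast (monicNormSq_pos σ hσ n).ne'
  have he := h3 ξ (Circle.norm_coe ξ).le
  have hne : (starPoly n (monicOPUC σ n)).eval (ξ : ℂ) ≠ 0 := by
    rw [← he]; exact Complex.exp_ne_zero _
  rw [norm_sq_eval_starPoly_orthonormalOPUC σ hσ, Complex.exp_neg, he, Complex.real_smul]
  rw [eval_starPoly_circle (natDegree_monicOPUC σ hσ n).le] at hne ⊢
  push_cast
  rw [← Complex.ofReal_pow, ← Complex.normSq_eq_norm_sq, ← Complex.mul_conj,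
    pow_sub₀ _ hξ hj.le, eval_pow, eval_X, map_pow, Circle.conj_coe, inv_pow]
  have h5 := (mul_ne_zero_iff.1 hne).2
  have h6 : (monicOPUC σ n).eval (ξ : ℂ) ≠ 0 := fun h0 => h5 (by rw [h0, map_zero])
  field_simp

/-- The recursion run backwards, $(1-|\gamma_k|^2)z\Phi_k=\Phi_{k+1}+\bar\gamma_k\Phi_{k+1}^*$,
passes orthogonality from $\Phi_{k+1}$ down to $\Phi_k$. -/
theorem polyInner_monicOPUC_X_pow_of_le (hγ : ∀ n, ‖schurParam σ n‖ < 1) (μ : Measure Circle)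
    [IsFiniteMeasure μ] {n : ℕ} (h : ∀ j < n, polyInner μ (monicOPUC σ n) (X ^ j) = 0)
    {k : ℕ} (hk : k ≤ n) : ∀ j < k, polyInner μ (monicOPUC σ k) (X ^ j) = 0 := by
  induction hk using Nat.decreasingInduction with
  | self => exact h
  | of_succ k _ ih =>
    intro j hj
    have e : C ((1 - ‖schurParam σ k‖ ^ 2 : ℝ) : ℂ) * (X * monicOPUC σ k)
        = monicOPUC σ (k + 1)
          + C (conj (schurParam σ k)) * starPoly (k + 1) (monicOPUC σ (k + 1)) := by
      have : ((1 - ‖schurParam σ k‖ ^ 2 : ℝ) : ℂ)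
          = 1 - conj (schurParam σ k) * schurParam σ k := by
        rw [← Complex.normSq_eq_conj_mul_self, Complex.normSq_eq_norm_sq]; push_cast; ring
      rw [starPoly_monicOPUC_succ σ hσ, monicOPUC_succ σ hσ, this, C_sub, C_1, C_mul]
      ring
    have h1 := congrArg (fun P => polyInner μ P (X ^ (j + 1))) e
    simp only [polyInner_add, polyInner_C_mul] at h1
    rw [pow_succ' (X : ℂ[X]) j, polyInner_X_mul, ← pow_succ' (X : ℂ[X]) j, ih (j + 1) (by omega),
      polyInner_starPoly_X_pow μ (by omega) (natDegree_monicOPUC σ hσ _).le,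
      ih (k + 1 - (j + 1)) (by omega), map_zero, mul_zero, add_zero, mul_eq_zero] at h1
    refine h1.resolve_left fun h0 => ?_
    have h2 : 1 - ‖schurParam σ k‖ ^ 2 = 0 := by exact_mod_cast h0
    nlinarith [hγ k, norm_nonneg (schurParam σ k)]

omit hσ in
-- Expanding $z^k$ in $\Phi_0,\dots,\Phi_k$ uses coefficients that depend on $\sigma$ alone, and
-- only $\Phi_0=1$ pairs nontrivially with $1$. The moments therefore agree up to the total mass of
-- `μ`.
theorem polyInner_X_pow_one (μ : Measure Circle) [IsFiniteMeasure μ] {n : ℕ}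
    (h : ∀ k ≤ n, k ≠ 0 → polyInner μ (monicOPUC σ k) 1 = 0)
    (h' : ∀ k ≤ n, k ≠ 0 → polyInner σ (monicOPUC σ k) 1 = 0) {k : ℕ} (hk : k ≤ n) :
    polyInner μ (X ^ k) 1 = polyInner μ 1 1 * polyInner σ (X ^ k) 1 := by
  have hone : polyInner σ 1 1 = 1 := by simp [polyInner]
  have key : ∀ j ≤ n, polyInner μ (monicOPUC σ j) 1
      = polyInner μ 1 1 * polyInner σ (monicOPUC σ j) 1 := by
    intro j hj
    rcases eq_or_ne j 0 with rfl | hj0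
    · have : monicOPUC σ 0 = 1 := by rw [monicOPUC]; simp
      rw [this, hone, mul_one]
    · rw [h j hj hj0, h' j hj hj0, mul_zero]
  have hX : ∀ ν : Measure Circle, IsFiniteMeasure ν → polyInner ν (X ^ k) 1
      = polyInner ν (monicOPUC σ k) 1 + ∑ j : Fin k, polyInner σ (X ^ k) (monicOPUC σ j) /
        polyInner σ (monicOPUC σ j) (monicOPUC σ j) * polyInner ν (monicOPUC σ j) 1 := by
    intro ν _
    have e : (X : ℂ[X]) ^ k = monicOPUC σ k + ∑ j : Fin k, (polyInner σ (X ^ k) (monicOPUC σ j) /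
        polyInner σ (monicOPUC σ j) (monicOPUC σ j)) • monicOPUC σ j := by
      conv_rhs => rw [monicOPUC.eq_1 σ k]
      simp only [smul_eq_C_mul, sub_add_cancel]
    change polyInnerLeft ν 1 (X ^ k) = _
    conv_lhs => rw [e]
    rw [map_add, map_sum]
    simp only [map_smul]
    rfl
  rw [hX μ inferInstance, hX σ inferInstance, key k hk, mul_add, Finset.mul_sum]
  congr 1
  refine Finset.sum_congr rfl fun j _ => ?_
  rw [key j (j.2.le.trans hk)]
  ring

omit hσ [IsProbabilityMeasure σ] in
theorem polyInner_X_pow_X_pow (μ : Measure Circle) {i j : ℕ} (hij : j ≤ i) :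
    polyInner μ (X ^ i) (X ^ j) = polyInner μ (X ^ (i - j)) 1 := by
  induction j generalizing i with
  | zero => simp
  | succ j ih =>
    obtain ⟨i, rfl⟩ : ∃ i', i = i' + 1 := ⟨i - 1, by omega⟩
    rw [pow_succ', pow_succ', polyInner_X_mul, ih (by omega), Nat.add_sub_add_right]

/-- The Bernstein–Szegő measure has the same moments as `σ` up to order `n`. -/
theorem polyInner_bernsteinSzego (hγ : ∀ n, ‖schurParam σ n‖ < 1) {n k : ℕ} (hk : k ≤ n) :
    polyInner (bernsteinSzego σ n) (X ^ k) 1 = polyInner σ (X ^ k) 1 := by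
  have := isFiniteMeasure_bernsteinSzego σ hσ n
  set μ := bernsteinSzego σ n with hμ
  have h1 : ∀ k ≤ n, k ≠ 0 → polyInner μ (monicOPUC σ k) 1 = 0 := fun k hk hk0 => by
    have := polyInner_monicOPUC_X_pow_of_le σ hσ hγ μ
      (fun j hj => polyInner_bernsteinSzego_monicOPUC σ hσ hj) hk 0 (Nat.pos_of_ne_zero hk0)
    rwa [pow_zero] at this
  have h2 : ∀ k ≤ n, k ≠ 0 → polyInner σ (monicOPUC σ k) 1 = 0 := fun k _ hk0 => by
    have := polyInner_monicOPUC_X_pow σ hσ (Nat.pos_of_ne_zero hk0)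
    rwa [pow_zero] at this
  -- It remains to see that the total mass is $1$. The moments agree up to the factor `M`, hence so
  -- do the squared norms of $\Phi_n$. Both of these equal `monicNormSq σ n`, because
  -- $|\Phi_n|^2/|\phi_n^*|^2$ is constant on the circle.
  set M := polyInner μ 1 1 with hM
  have hMr : conj M = M := polyInner_conj μ 1 1
  have h3 : ∀ i ≤ n, ∀ j ≤ n, polyInner μ (X ^ i) (X ^ j) = M * polyInner σ (X ^ i) (X ^ j) := by
    intro i hi j hj
    rcases le_total j i with hij | hij
    · rw [polyInner_X_pow_X_pow μ hij, polyInner_X_pow_X_pow σ hij,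
        polyInner_X_pow_one σ μ h1 h2 (by omega)]
    · rw [← polyInner_conj μ, ← polyInner_conj σ, polyInner_X_pow_X_pow μ hij,
        polyInner_X_pow_X_pow σ hij, polyInner_X_pow_one σ μ h1 h2 (k := j - i) (by omega),
        map_mul, hMr]
  have hd := natDegree_monicOPUC σ hσ n
  have h4 : ∀ j ≤ n, polyInner μ (monicOPUC σ n) (X ^ j)
      = M * polyInner σ (monicOPUC σ n) (X ^ j) := by
    intro j hj
    rw [polyInner_eq_sum, polyInner_eq_sum, Finset.mul_sum]
    refine Finset.sum_congr rfl fun i hi => ?_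
    rw [h3 i (by rw [hd] at hi; exact Nat.lt_succ_iff.1 (Finset.mem_range.1 hi)) j hj]
    ring
  have h5 : polyInner μ (monicOPUC σ n) (monicOPUC σ n)
      = M * polyInner σ (monicOPUC σ n) (monicOPUC σ n) := by
    rw [polyInner_eq_sum, polyInner_eq_sum, Finset.mul_sum]
    refine Finset.sum_congr rfl fun i hi => ?_
    have hi' : i ≤ n := by rw [hd] at hi; exact Nat.lt_succ_iff.1 (Finset.mem_range.1 hi)
    rw [← polyInner_conj μ, ← polyInner_conj σ, h4 i hi', map_mul, hMr]
    ring
  have h6 : polyInner μ (monicOPUC σ n) (monicOPUC σ n) = monicNormSq σ n := by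
    rw [polyInner_self_eq, hμ, integral_bernsteinSzego σ hσ]
    congr 1
    have : ∀ ξ : Circle, (‖(starPoly n (orthonormalOPUC σ n)).eval (ξ : ℂ)‖ ^ 2)⁻¹ •
        ‖(monicOPUC σ n).eval (ξ : ℂ)‖ ^ 2 = monicNormSq σ n := fun ξ => by
      have h0 := eval_starPoly_orthonormalOPUC_ne_zero σ hσ n ξ
      have h0' := pow_ne_zero 2 (norm_ne_zero_iff.2 h0)
      have hN := (monicNormSq_pos σ hσ n).ne'
      have hs := norm_sq_eval_starPoly_orthonormalOPUC σ hσ n ξ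
      have : ‖(monicOPUC σ n).eval (ξ : ℂ)‖ ^ 2 = monicNormSq σ n *
          ‖(starPoly n (orthonormalOPUC σ n)).eval (ξ : ℂ)‖ ^ 2 := by
        rw [hs]; field_simp
      rw [this, smul_eq_mul]
      field_simp
    simp_rw [this]
    simp
  have h7 : polyInner σ (monicOPUC σ n) (monicOPUC σ n) = monicNormSq σ n :=
    polyInner_self_eq σ _
  have hN : (monicNormSq σ n : ℂ) ≠ 0 := by exact_mod_cast (monicNormSq_pos σ hσ n).ne'
  have hM1 : M = 1 := by
    rw [h6, h7] at h5
    exact mul_right_cancel₀ hN (by rw [← h5, one_mul])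
  rw [polyInner_X_pow_one σ μ h1 h2 hk, ← hM, hM1, one_mul]

end BernsteinSzego

/-! ### Weak convergence of the Bernstein–Szegő measures. -/

section WeakConvergence

theorem polyInner_X_pow_one_eq (μ : Measure Circle) (k : ℕ) :
    polyInner μ (X ^ k) 1 = ∫ ξ : Circle, (ξ : ℂ) ^ k ∂μ := by
  simp [polyInner]

/-- Trigonometric polynomials are uniformly dense in the continuous functions on the circle. -/
theorem exists_sum_zpow_circle_near (g : C(Circle, ℂ)) {ε : ℝ} (hε : 0 < ε) :
    ∃ c : ℤ →₀ ℂ, ∀ ξ : Circle, ‖g ξ - c.sum fun k a => a * (ξ : ℂ) ^ k‖ ≤ ε := by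
  have : Fact (0 < 2 * Real.pi) := ⟨Real.two_pi_pos⟩
  set e : C(AddCircle (2 * Real.pi), Circle) := ⟨AddCircle.toCircle, AddCircle.continuous_toCircle⟩
  have hmem : g.comp e ∈
      (Submodule.span ℂ (Set.range (@fourier (2 * Real.pi)))).topologicalClosure := by
    rw [span_fourier_closure_eq_top]; trivial
  obtain ⟨p, hp, hd⟩ := Metric.mem_closure_iff.1 hmem ε hε
  obtain ⟨c, rfl⟩ := (Finsupp.mem_span_range_iff_exists_finsupp).1 hp
  refine ⟨c, fun ξ => ?_⟩
  obtain ⟨x, rfl⟩ : ∃ x, AddCircle.toCircle (T := 2 * Real.pi) x = ξ :=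
    by
    obtain ⟨x, hx⟩ := (AddCircle.homeomorphCircle Real.two_pi_pos.ne').surjective ξ
    exact ⟨x, by rw [← hx, AddCircle.homeomorphCircle_apply]⟩
  have h1 := (ContinuousMap.dist_apply_le_dist (f := g.comp e)
    (g := c.sum fun i a => a • fourier i) x).trans hd.le
  rw [dist_eq_norm] at h1
  have e2 : (c.sum fun k a => a * (AddCircle.toCircle x : ℂ) ^ k)
      = (c.sum fun i a => a • fourier i : C(AddCircle (2 * Real.pi), ℂ)) x := by
    simp only [Finsupp.sum, ContinuousMap.sum_apply, ContinuousMap.smul_apply, smul_eq_mul]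
    refine Finset.sum_congr rfl fun k _ => ?_
    rw [fourier_apply, AddCircle.toCircle_zsmul, Circle.coe_zpow]
  rw [e2]
  exact h1

variable (σ : Measure Circle) [IsProbabilityMeasure σ] (hσ : σ.support.Infinite)

include hσ

theorem integral_zpow_bernsteinSzego (hγ : ∀ n, ‖schurParam σ n‖ < 1) {n : ℕ} {k : ℤ}
    (hk : k.natAbs ≤ n) :
    ∫ ξ : Circle, (ξ : ℂ) ^ k ∂bernsteinSzego σ n = ∫ ξ : Circle, (ξ : ℂ) ^ k ∂σ := by
  have h := polyInner_bernsteinSzego σ hσ hγ hk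
  rw [polyInner_X_pow_one_eq, polyInner_X_pow_one_eq] at h
  rcases Int.natAbs_eq k with hk' | hk'
  · rw [hk']
    simpa only [zpow_natCast] using h
  · rw [hk']
    have h2 := congrArg conj h
    rw [← integral_conj, ← integral_conj] at h2
    simpa only [map_pow, Circle.conj_coe, zpow_neg, zpow_natCast, inv_pow] using h2

theorem isProbabilityMeasure_bernsteinSzego (hγ : ∀ n, ‖schurParam σ n‖ < 1) (n : ℕ) :
    IsProbabilityMeasure (bernsteinSzego σ n) := by
  have := isFiniteMeasure_bernsteinSzego σ hσ n
  have h := integral_zpow_bernsteinSzego σ hσ hγ (n := n) (k := 0) (by simp)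
  simp only [zpow_zero, integral_const, probReal_univ, one_smul] at h
  refine ⟨?_⟩
  have h1 : (bernsteinSzego σ n).real Set.univ = 1 := by
    rw [Complex.real_smul, mul_one] at h; exact_mod_cast h
  rwa [Measure.real, ENNReal.toReal_eq_one_iff] at h1

theorem tendsto_integral_bernsteinSzego (hγ : ∀ n, ‖schurParam σ n‖ < 1) (g : C(Circle, ℂ)) :
    Tendsto (fun n => ∫ ξ, g ξ ∂bernsteinSzego σ n) atTop (𝓝 (∫ ξ, g ξ ∂σ)) := by
  rw [Metric.tendsto_atTop]
  intro ε hε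
  obtain ⟨c, hc⟩ := exists_sum_zpow_circle_near g (ε := ε / 3) (by positivity)
  set p : Circle → ℂ := fun ξ => c.sum fun k a => a * (ξ : ℂ) ^ k with hp
  have hzc : ∀ k : ℤ, Continuous fun ξ : Circle => (ξ : ℂ) ^ k := fun k =>
    continuous_subtype_val.zpow₀ k fun ξ => Or.inl (Circle.coe_ne_zero ξ)
  have hpc : Continuous p := continuous_finsetSum _ fun k _ => continuous_const.mul (hzc k)
  have hnear : ∀ μ : Measure Circle, IsProbabilityMeasure μ →
      ‖(∫ ξ, g ξ ∂μ) - ∫ ξ, p ξ ∂μ‖ ≤ ε / 3 := by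
    intro μ _
    rw [← integral_sub g.continuous.integrable_circle hpc.integrable_circle]
    refine (norm_integral_le_of_norm_le_const (Eventually.of_forall hc)).trans ?_
    simp
  have hpint : ∀ μ : Measure Circle, IsProbabilityMeasure μ →
      ∫ ξ, p ξ ∂μ = c.sum fun k a => a * ∫ ξ : Circle, (ξ : ℂ) ^ k ∂μ := by
    intro μ _
    simp only [hp, Finsupp.sum]
    rw [integral_finsetSum _ fun k _ => ((hzc k).integrable_circle.const_mul _)]
    exact Finset.sum_congr rfl fun k _ => integral_const_mul _ _
  -- From the degree of the trigonometric polynomial `p` onwards, its integrals agree exactly.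
  refine ⟨c.support.sup Int.natAbs, fun n hn => ?_⟩
  have hprob := isProbabilityMeasure_bernsteinSzego σ hσ hγ n
  have heq : ∫ ξ, p ξ ∂bernsteinSzego σ n = ∫ ξ, p ξ ∂σ := by
    rw [hpint _ hprob, hpint σ inferInstance]
    refine Finset.sum_congr rfl fun k hk => ?_
    exact congrArg (c k * ·)
      (integral_zpow_bernsteinSzego σ hσ hγ ((Finset.le_sup hk).trans hn))
  have h1 := hnear _ hprob
  have h2 := hnear σ inferInstance
  rw [dist_eq_norm]
  calc ‖(∫ ξ, g ξ ∂bernsteinSzego σ n) - ∫ ξ, g ξ ∂σ‖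
      = ‖((∫ ξ, g ξ ∂bernsteinSzego σ n) - ∫ ξ, p ξ ∂bernsteinSzego σ n)
          - ((∫ ξ, g ξ ∂σ) - ∫ ξ, p ξ ∂σ)‖ := by rw [heq]; congr 1; ring
    _ ≤ ε / 3 + ε / 3 := (norm_sub_le _ _).trans (add_le_add h1 h2)
    _ < ε := by linarith

end WeakConvergence

/-! ### Comparison of measures and convergence lemmas -/

/-- Indicators of closed sets are limits of bounded continuous functions, and finite Borel measures
are inner regular for closed sets. -/
theorem measure_le_of_forall_lintegral_le {Ω : Type*} [MeasurableSpace Ω] [TopologicalSpace Ω]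
    [TopologicalSpace.PseudoMetrizableSpace Ω] [BorelSpace Ω] {μ ν : Measure Ω} [IsFiniteMeasure μ]
    [IsFiniteMeasure ν]
    (h : ∀ f : BoundedContinuousFunction Ω NNReal, ∫⁻ x, f x ∂μ ≤ ∫⁻ x, f x ∂ν) : μ ≤ ν := by
  have hF : ∀ F : Set Ω, IsClosed F → μ F ≤ ν F := fun F hF =>
    le_of_tendsto_of_tendsto' (HasOuterApproxClosed.tendsto_lintegral_apprSeq hF μ)
      (HasOuterApproxClosed.tendsto_lintegral_apprSeq hF ν) fun n => h _
  refine Measure.le_iff.2 fun s hs => ?_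
  rw [hs.measure_eq_iSup_isClosed_of_ne_top (measure_ne_top μ s)]
  refine iSup₂_le fun F hFs => iSup_le fun hFc => (hF F hFc).trans (measure_mono hFs)

/-- Intersecting with a set `S` of full `μ`-measure that is null for the singular part leaves only
the absolutely continuous part of `ν`. -/
theorem ae_le_rnDeriv_of_withDensity_le {Ω : Type*} [MeasurableSpace Ω] {μ ν : Measure Ω}
    [IsFiniteMeasure μ] [IsFiniteMeasure ν] {v : Ω → ℝ≥0∞} (hv : AEMeasurable v μ)
    (h : μ.withDensity v ≤ ν) : v ≤ᵐ[μ] ν.rnDeriv μ := by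
  refine ae_le_of_forall_setLIntegral_le_of_sigmaFinite₀ hv fun s hs _ => ?_
  obtain ⟨S, hS, hS1, hS2⟩ := Measure.mutuallySingular_singularPart ν μ
  have hd := ν.haveLebesgueDecomposition_add μ
  have e1 : ∫⁻ x in s, v x ∂μ = μ.withDensity v (s ∩ S) := by
    rw [withDensity_apply _ (hs.inter hS)]
    exact setLIntegral_congr (inter_ae_eq_left_of_ae_eq_univ (ae_eq_univ.2 hS2)).symm
  rw [e1]
  calc μ.withDensity v (s ∩ S) ≤ ν (s ∩ S) := h _
    _ = ν.singularPart μ (s ∩ S) + μ.withDensity (ν.rnDeriv μ) (s ∩ S) := by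
        conv_lhs => rw [hd]
        rfl
    _ ≤ 0 + μ.withDensity (ν.rnDeriv μ) s := by
        gcongr
        · exact (measure_mono Set.inter_subset_right).trans hS1.le
        · exact Set.inter_subset_left
    _ = ∫⁻ x in s, ν.rnDeriv μ x ∂μ := by rw [zero_add, withDensity_apply _ hs]

/-- Almost everywhere convergence with bounded second moments implies convergence in mean. -/
theorem tendsto_integral_norm_sub_of_sq_bounded {Ω : Type*} [MeasurableSpace Ω] {μ : Measure Ω}
    [IsProbabilityMeasure μ] {u : ℕ → Ω → ℂ} {v : Ω → ℂ} (hu : ∀ n, MemLp (u n) 2 μ)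
    (hv : MemLp v 2 μ) {B : ℝ} (hb : ∀ n, ∫ x, ‖u n x‖ ^ 2 ∂μ ≤ B)
    (h : ∀ᵐ x ∂μ, Tendsto (fun n => u n x) atTop (𝓝 (v x))) :
    Tendsto (fun n => ∫ x, ‖u n x - v x‖ ∂μ) atTop (𝓝 0) := by
  set S : ℝ := 2 * (B + ∫ x, ‖v x‖ ^ 2 ∂μ) with hS
  have hB : 0 ≤ B := (integral_nonneg fun _ => by positivity).trans (hb 0)
  have hS0 : 0 ≤ S := by
    have : 0 ≤ ∫ x, ‖v x‖ ^ 2 ∂μ := integral_nonneg fun _ => by positivity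
    positivity
  have hsq : ∀ n, Integrable (fun x => ‖u n x - v x‖ ^ 2) μ := fun n =>
    (memLp_two_iff_integrable_sq_norm ((hu n).1.sub hv.1)).1 ((hu n).sub hv)
  have husq : ∀ n, Integrable (fun x => ‖u n x‖ ^ 2) μ := fun n =>
    (memLp_two_iff_integrable_sq_norm (hu n).1).1 (hu n)
  have hvsq : Integrable (fun x => ‖v x‖ ^ 2) μ := (memLp_two_iff_integrable_sq_norm hv.1).1 hv
  have hint : ∀ n, Integrable (fun x => ‖u n x - v x‖) μ := fun n =>
    (((hu n).sub hv).integrable one_le_two).norm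
  have hSb : ∀ n, ∫ x, ‖u n x - v x‖ ^ 2 ∂μ ≤ S := fun n => by
    calc ∫ x, ‖u n x - v x‖ ^ 2 ∂μ ≤ ∫ x, 2 * (‖u n x‖ ^ 2 + ‖v x‖ ^ 2) ∂μ := by
          refine integral_mono (hsq n) (((husq n).add hvsq).const_mul 2) fun x => ?_
          have := norm_sub_le (u n x) (v x)
          have := norm_nonneg (u n x - v x)
          nlinarith [sq_nonneg (‖u n x‖ - ‖v x‖)]
      _ = 2 * ((∫ x, ‖u n x‖ ^ 2 ∂μ) + ∫ x, ‖v x‖ ^ 2 ∂μ) := by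
          rw [integral_const_mul, integral_add (husq n) hvsq]
      _ ≤ S := by rw [hS]; gcongr; exact hb n
  rw [Metric.tendsto_atTop]
  intro ε hε
  -- Above the level `K` the integrand is at most its square divided by `K`, which contributes at
  -- most $S/K<\varepsilon/2$. The truncation at `K` is handled by dominated convergence.
  set K : ℝ := 2 * S / ε + 1 with hK
  have hKpos : 0 < K := by positivity
  have hmin : Tendsto (fun n => ∫ x, min ‖u n x - v x‖ K ∂μ) atTop (𝓝 (∫ _, (0 : ℝ) ∂μ)) := by
    refine tendsto_integral_of_dominated_convergence (fun _ => K)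
      (fun n => ((hint n).1.inf aestronglyMeasurable_const)) (integrable_const K)
      (fun n => Eventually.of_forall fun x => ?_) ?_
    · rw [Real.norm_of_nonneg (le_min (norm_nonneg _) hKpos.le)]
      exact min_le_right _ _
    · filter_upwards [h] with x hx
      have h1 := (tendsto_iff_norm_sub_tendsto_zero.1 hx).min (tendsto_const_nhds (x := K))
      rwa [min_eq_left hKpos.le] at h1
  rw [integral_zero] at hmin
  obtain ⟨N, hN⟩ := Metric.tendsto_atTop.1 hmin (ε / 2) (by positivity)
  refine ⟨N, fun n hn => ?_⟩
  have h1 := hN n hn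
  rw [Real.dist_0_eq_abs] at h1 ⊢
  rw [abs_of_nonneg (integral_nonneg fun _ => norm_nonneg _)]
  have hmi : Integrable (fun x => min ‖u n x - v x‖ K) μ := (hint n).inf (integrable_const K)
  have h2 : ∫ x, ‖u n x - v x‖ ∂μ ≤ ∫ x, (min ‖u n x - v x‖ K + ‖u n x - v x‖ ^ 2 / K) ∂μ := by
    refine integral_mono (hint n) (hmi.add ((hsq n).div_const K)) fun x => ?_
    simp only
    have h0 := norm_nonneg (u n x - v x)
    rcases le_total ‖u n x - v x‖ K with hle | hle
    · rw [min_eq_left hle]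
      have : 0 ≤ ‖u n x - v x‖ ^ 2 / K := by positivity
      linarith
    · rw [min_eq_right hle]
      have : ‖u n x - v x‖ ≤ ‖u n x - v x‖ ^ 2 / K := by
        rw [le_div_iff₀ hKpos]; nlinarith
      linarith
  rw [integral_add hmi ((hsq n).div_const K), integral_div] at h2
  have h3 : (∫ x, ‖u n x - v x‖ ^ 2 ∂μ) / K < ε / 2 := by
    rw [div_lt_iff₀ hKpos]
    have : ε / 2 * K = S + ε / 2 := by rw [hK]; field_simp
    rw [this]
    linarith [hSb n]
  linarith [le_abs_self (∫ x, min ‖u n x - v x‖ K ∂μ)]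

theorem tendsto_integral_continuous_smul {μ : Measure Circle} [IsFiniteMeasure μ]
    {u : ℕ → Circle → ℂ} {v : Circle → ℂ} (hu : ∀ n, Integrable (u n) μ) (hv : Integrable v μ)
    (h : Tendsto (fun n => ∫ x, ‖u n x - v x‖ ∂μ) atTop (𝓝 0)) {P : Circle → ℝ}
    (hP : Continuous P) :
    Tendsto (fun n => ∫ ξ, P ξ • u n ξ ∂μ) atTop (𝓝 (∫ ξ, P ξ • v ξ ∂μ)) := by
  rw [tendsto_iff_norm_sub_tendsto_zero]
  set M := ‖(⟨P, hP⟩ : C(Circle, ℝ))‖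
  have hM : ∀ ξ, ‖P ξ‖ ≤ M := fun ξ => ContinuousMap.norm_coe_le_norm ⟨P, hP⟩ ξ
  have h1 := h.const_mul M
  rw [mul_zero] at h1
  refine squeeze_zero (fun n => norm_nonneg _) (fun n => ?_) h1
  rw [← integral_sub ((hu n).continuous_smul hP) (hv.continuous_smul hP), ← integral_const_mul]
  refine norm_integral_le_of_norm_le (((hu n).sub hv).norm.const_mul M)
    (Eventually.of_forall fun ξ => ?_)
  rw [← smul_sub, norm_smul]
  exact mul_le_mul_of_nonneg_right (hM ξ) (norm_nonneg _)

/-! ### Boundary behaviour of the Szegő function -/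

section Boundary

variable (σ : Measure Circle) [IsProbabilityMeasure σ] (hσ : σ.support.Infinite)

include hσ

theorem tendsto_lintegral_bernsteinSzego (hγ : ∀ n, ‖schurParam σ n‖ < 1)
    (g : BoundedContinuousFunction Circle NNReal) :
    Tendsto (fun n => ∫⁻ ξ, g ξ ∂bernsteinSzego σ n) atTop (𝓝 (∫⁻ ξ, g ξ ∂σ)) := by
  have hgc : Continuous fun ξ => ((g ξ : ℝ) : ℂ) :=
    Complex.continuous_ofReal.comp (NNReal.continuous_coe.comp g.continuous)
  have h := tendsto_integral_bernsteinSzego σ hσ hγ ⟨_, hgc⟩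
  have key : ∀ μ : Measure Circle, IsProbabilityMeasure μ →
      ∫⁻ ξ, g ξ ∂μ = ENNReal.ofReal (∫ ξ, ((g ξ : ℝ) : ℂ) ∂μ).re := by
    intro μ _
    rw [integral_complex_ofReal, Complex.ofReal_re, ofReal_integral_eq_lintegral_ofReal
      (show Continuous fun ξ => (g ξ : ℝ) from
        NNReal.continuous_coe.comp g.continuous).integrable_circle
      (Eventually.of_forall fun ξ => (g ξ).2)]
    simp
  rw [key σ inferInstance]
  simp_rw [fun n => key _ (isProbabilityMeasure_bernsteinSzego σ hσ hγ n)]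
  exact ENNReal.tendsto_ofReal ((Complex.continuous_re.tendsto _).comp h)

variable {L : Circle → ℂ}
  (hL : ∀ᵐ ξ : Circle ∂circleMeasure,
    Tendsto (fun n => (starPoly n (orthonormalOPUC σ n)).eval (ξ : ℂ)) atTop (𝓝 (L ξ)))

include hL

omit hσ [IsProbabilityMeasure σ] in
theorem aestronglyMeasurable_limit : AEStronglyMeasurable L circleMeasure :=
  aestronglyMeasurable_of_tendsto_ae atTop
    (fun _ => (continuous_eval_circle _).aestronglyMeasurable) hL

variable (hL0 : ∀ᵐ ξ ∂circleMeasure, L ξ ≠ 0)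

include hL0

/-- Fatou against a continuous $g\ge0$: $\int g|L|^{-2}dm\le\liminf\int g|\phi_n^*|^{-2}dm=\int
g\,d\sigma$ by weak convergence. -/
theorem ofReal_inv_le_rnDeriv (hγ : ∀ n, ‖schurParam σ n‖ < 1) :
    (fun ξ => ENNReal.ofReal (‖L ξ‖ ^ 2)⁻¹) ≤ᵐ[circleMeasure] σ.rnDeriv circleMeasure := by
  have hLm := aestronglyMeasurable_limit σ hL
  have hv : AEMeasurable (fun ξ => ENNReal.ofReal (‖L ξ‖ ^ 2)⁻¹) circleMeasure :=
    (hLm.norm.aemeasurable.pow_const 2).inv.ennreal_ofReal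
  have hle : ∀ g : BoundedContinuousFunction Circle NNReal,
      ∫⁻ ξ, g ξ ∂circleMeasure.withDensity (fun ξ => ENNReal.ofReal (‖L ξ‖ ^ 2)⁻¹)
        ≤ ∫⁻ ξ, g ξ ∂σ := by
    intro g
    have hgm : Measurable fun ξ => (g ξ : ℝ≥0∞) := g.continuous.measurable.coe_nnreal_ennreal
    rw [lintegral_withDensity_eq_lintegral_mul₀ hv hgm.aemeasurable,
      ← (tendsto_lintegral_bernsteinSzego σ hσ hγ g).liminf_eq]
    have hdm : ∀ n, Measurable fun ξ : Circle =>
        ENNReal.ofReal (‖(starPoly n (orthonormalOPUC σ n)).eval (ξ : ℂ)‖ ^ 2)⁻¹ := fun n =>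
      (continuous_bernsteinSzego_density σ hσ n).measurable.ennreal_ofReal
    have e : ∀ n, ∫⁻ ξ, g ξ ∂bernsteinSzego σ n = ∫⁻ ξ : Circle,
        ENNReal.ofReal (‖(starPoly n (orthonormalOPUC σ n)).eval (ξ : ℂ)‖ ^ 2)⁻¹ * g ξ
          ∂circleMeasure := fun n => by
      rw [bernsteinSzego, lintegral_withDensity_eq_lintegral_mul₀ (hdm n).aemeasurable
        hgm.aemeasurable]
      rfl
    simp_rw [e]
    refine le_trans (le_of_eq ?_) (lintegral_liminf_le fun n => (hdm n).mul hgm)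
    refine lintegral_congr_ae ?_
    filter_upwards [hL, hL0] with ξ h1 h2
    have h3 : Tendsto (fun n => ENNReal.ofReal
        (‖(starPoly n (orthonormalOPUC σ n)).eval (ξ : ℂ)‖ ^ 2)⁻¹ * g ξ) atTop
        (𝓝 (ENNReal.ofReal (‖L ξ‖ ^ 2)⁻¹ * g ξ)) :=
      ENNReal.Tendsto.mul_const (ENNReal.tendsto_ofReal ((h1.norm.pow 2).inv₀
        (pow_ne_zero 2 (norm_ne_zero_iff.2 h2)))) (Or.inr ENNReal.coe_ne_top)
    rw [h3.liminf_eq]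
    rfl
  have hfin : IsFiniteMeasure
      (circleMeasure.withDensity fun ξ => ENNReal.ofReal (‖L ξ‖ ^ 2)⁻¹) := by
    refine ⟨?_⟩
    have := hle 1
    simp only [BoundedContinuousFunction.coe_one, Pi.one_apply, ENNReal.coe_one, lintegral_const,
      one_mul, measure_univ] at this
    exact this.trans_lt ENNReal.one_lt_top
  exact ae_le_rnDeriv_of_withDensity_le hv (measure_le_of_forall_lintegral_le hle)

omit hL0 in
-- Drop the singular part in $\int|\phi_n^*|^2d\sigma=1$ and apply Fatou.
theorem lintegral_norm_sq_mul_rnDeriv_le :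
    ∫⁻ ξ, ENNReal.ofReal (‖L ξ‖ ^ 2) * σ.rnDeriv circleMeasure ξ ∂circleMeasure ≤ 1 := by
  have hfm : ∀ n, Measurable fun ξ : Circle =>
      ENNReal.ofReal (‖(starPoly n (orthonormalOPUC σ n)).eval (ξ : ℂ)‖ ^ 2) := fun n =>
    ((continuous_eval_circle _).norm.pow 2).measurable.ennreal_ofReal
  have hb : ∀ n, ∫⁻ ξ : Circle,
      ENNReal.ofReal (‖(starPoly n (orthonormalOPUC σ n)).eval (ξ : ℂ)‖ ^ 2)
        * σ.rnDeriv circleMeasure ξ ∂circleMeasure ≤ 1 := by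
    intro n
    calc _ = ∫⁻ ξ : Circle, ENNReal.ofReal (‖(starPoly n (orthonormalOPUC σ n)).eval (ξ : ℂ)‖ ^ 2)
            ∂circleMeasure.withDensity (σ.rnDeriv circleMeasure) := by
          rw [lintegral_withDensity_eq_lintegral_mul _ (Measure.measurable_rnDeriv _ _) (hfm n)]
          refine lintegral_congr fun ξ => ?_
          rw [mul_comm]; rfl
      _ ≤ ∫⁻ ξ : Circle, ENNReal.ofReal (‖(starPoly n (orthonormalOPUC σ n)).eval (ξ : ℂ)‖ ^ 2)
            ∂σ := lintegral_mono' (Measure.withDensity_rnDeriv_le _ _) le_rfl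
      _ = 1 := by
          have hc : Continuous fun ξ : Circle =>
              ‖(starPoly n (orthonormalOPUC σ n)).eval (ξ : ℂ)‖ ^ 2 :=
            (continuous_eval_circle _).norm.pow 2
          refine (ofReal_integral_eq_lintegral_ofReal hc.integrable_circle
            (Eventually.of_forall fun _ => by positivity)).symm.trans ?_
          rw [integral_norm_sq_starPoly_orthonormalOPUC σ hσ, ENNReal.ofReal_one]
  have hfat := lintegral_liminf_le (μ := circleMeasure) (u := atTop)
    fun n => (hfm n).mul (Measure.measurable_rnDeriv σ circleMeasure)
  refine le_trans (le_of_eq ?_) (hfat.trans ((liminf_le_liminf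
    (Eventually.of_forall hb)).trans (by simp)))
  refine lintegral_congr_ae ?_
  filter_upwards [hL, Measure.rnDeriv_lt_top σ circleMeasure] with ξ h1 h2
  exact (ENNReal.Tendsto.mul_const (ENNReal.tendsto_ofReal (h1.norm.pow 2))
    (Or.inr h2.ne)).liminf_eq.symm

/-- The density of `σ` is the limit of the densities of the Bernstein–Szegő measures. -/
theorem acDensity_eq_inv_norm_sq (hγ : ∀ n, ‖schurParam σ n‖ < 1) :
    ∀ᵐ ξ ∂circleMeasure, acDensity σ ξ = (‖L ξ‖ ^ 2)⁻¹ := by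
  have hLm := aestronglyMeasurable_limit σ hL
  -- A function that is at least $1$ a.e. and has integral at most $1$ over a probability space
  -- equals $1$ a.e.
  have h1 : (fun _ => 1) ≤ᵐ[circleMeasure]
      fun ξ => ENNReal.ofReal (‖L ξ‖ ^ 2) * σ.rnDeriv circleMeasure ξ := by
    filter_upwards [ofReal_inv_le_rnDeriv σ hσ hL hL0 hγ, hL0] with ξ h2 h3
    have h4 : 0 < ‖L ξ‖ ^ 2 := by positivity
    calc (1 : ℝ≥0∞) = ENNReal.ofReal (‖L ξ‖ ^ 2) * ENNReal.ofReal (‖L ξ‖ ^ 2)⁻¹ := by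
          rw [← ENNReal.ofReal_mul h4.le, mul_inv_cancel₀ h4.ne', ENNReal.ofReal_one]
      _ ≤ _ := mul_le_mul_right h2 _
  have h2 := ae_eq_of_ae_le_of_lintegral_le h1 (by simp)
    ((hLm.norm.aemeasurable.pow_const 2).ennreal_ofReal.mul
      (Measure.measurable_rnDeriv σ circleMeasure).aemeasurable)
    (by simpa using lintegral_norm_sq_mul_rnDeriv_le σ hσ hL)
  filter_upwards [h2, hL0] with ξ h3 h4
  have h5 : 0 < ‖L ξ‖ ^ 2 := by positivity
  have h6 := congrArg ENNReal.toReal h3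
  rw [ENNReal.toReal_one, ENNReal.toReal_mul, ENNReal.toReal_ofReal h5.le] at h6
  rw [acDensity]
  field_simp
  linarith

variable {H : Circle → ℝ} (hH : Integrable H circleMeasure)
  (hdom : ∀ᶠ n in atTop, ∀ᵐ ξ : Circle ∂circleMeasure,
    |Real.log ‖(starPoly n (orthonormalOPUC σ n)).eval (ξ : ℂ)‖| ≤ H ξ)

include hH hdom

omit hσ [IsProbabilityMeasure σ] hH in
theorem abs_log_norm_limit_le : ∀ᵐ ξ ∂circleMeasure, |Real.log ‖L ξ‖| ≤ H ξ := by
  obtain ⟨N, hN⟩ := eventually_atTop.1 hdom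
  have hdom' : ∀ᵐ ξ : Circle ∂circleMeasure, ∀ n ≥ N,
      |Real.log ‖(starPoly n (orthonormalOPUC σ n)).eval (ξ : ℂ)‖| ≤ H ξ :=
    ae_all_iff.2 fun n => ae_all_iff.2 fun hn => hN n hn
  filter_upwards [hL, hL0, hdom'] with ξ h1 h2 h3
  exact le_of_tendsto ((Real.continuousAt_log (norm_ne_zero_iff.2 h2)).tendsto.comp h1.norm).abs
    (eventually_atTop.2 ⟨N, h3⟩)

theorem inSzegoClass_of_dominated (hγ : ∀ n, ‖schurParam σ n‖ < 1) : InSzegoClass σ := by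
  have hw := acDensity_eq_inv_norm_sq σ hσ hL hL0 hγ
  refine ⟨?_, ?_⟩
  · filter_upwards [hw, hL0] with ξ h1 h2
    rw [h1]; positivity
  · have hlog : Integrable (fun ξ => Real.log ‖L ξ‖) circleMeasure :=
      hH.mono' (aestronglyMeasurable_limit σ hL).norm.aemeasurable.log.aestronglyMeasurable
        (abs_log_norm_limit_le σ hL hL0 hdom)
    refine (hlog.const_mul (-2)).congr ?_
    filter_upwards [hw] with ξ h1
    rw [h1, Real.log_inv, Real.log_pow]
    push_cast; ring

/-- Both sides are exponentials of Schwarz integrals, of $-\log|\phi_n^*|$ and of $\frac12\log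
w=-\log|L|$. For fixed $z$ the kernel is bounded, so a multiple of `H` dominates. -/
theorem tendsto_inv_eval_szegoFunction (hγ : ∀ n, ‖schurParam σ n‖ < 1) {z : ℂ} (hz : ‖z‖ < 1) :
    Tendsto (fun n => ((starPoly n (orthonormalOPUC σ n)).eval z)⁻¹) atTop
      (𝓝 (szegoFunction σ z)) := by
  set S : Circle → ℂ := fun ξ => ((ξ : ℂ) + z) / ((ξ : ℂ) - z) with hS
  have hSc : Continuous S := continuous_herglotz_circle hz
  have hw := acDensity_eq_inv_norm_sq σ hσ hL hL0 hγ
  have e1 : szegoFunction σ z = Complex.exp (-∫ ξ, S ξ * (Real.log ‖L ξ‖ : ℂ) ∂circleMeasure) := by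
    rw [szegoFunction, ← integral_const_mul, ← integral_neg]
    congr 1
    refine integral_congr_ae ?_
    filter_upwards [hw] with ξ h1
    rw [h1, Real.log_inv, Real.log_pow]
    push_cast; ring
  have e2 : ∀ n, ((starPoly n (orthonormalOPUC σ n)).eval z)⁻¹ = Complex.exp
      (-∫ ξ : Circle, S ξ * (Real.log ‖(starPoly n (orthonormalOPUC σ n)).eval (ξ : ℂ)‖ : ℂ)
        ∂circleMeasure) := fun n => by
    obtain ⟨h, h1, h2, h3⟩ := exists_log_starPoly_orthonormalOPUC σ hσ n
    rw [Complex.exp_neg, ← h3 z hz.le, ← h1.integral_herglotz_re h2 hz]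
    congr 2
    refine integral_congr_ae (Eventually.of_forall fun ξ => ?_)
    simp only [hS]
    rw [← h3 ξ (Circle.norm_coe ξ).le, Complex.norm_exp, Real.log_exp]
  rw [e1]
  simp_rw [e2]
  refine (Complex.continuous_exp.tendsto _).comp (Tendsto.neg ?_)
  set M := ‖(⟨S, hSc⟩ : C(Circle, ℂ))‖
  have hM : ∀ ξ, ‖S ξ‖ ≤ M := fun ξ => ContinuousMap.norm_coe_le_norm ⟨S, hSc⟩ ξ
  refine tendsto_integral_filter_of_dominated_convergence (fun ξ => M * H ξ)
    (Eventually.of_forall fun n => ?_) ?_ (hH.const_mul M) ?_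
  · exact hSc.aestronglyMeasurable.mul (Complex.measurable_ofReal.comp
      (Real.measurable_log.comp
        (continuous_eval_circle _).norm.measurable)).aestronglyMeasurable
  · filter_upwards [hdom] with n hn
    filter_upwards [hn] with ξ h1
    rw [norm_mul, Complex.norm_real, Real.norm_eq_abs]
    exact mul_le_mul (hM ξ) h1 (abs_nonneg _) ((norm_nonneg _).trans (hM ξ))
  · filter_upwards [hL, hL0] with ξ h1 h2
    refine Tendsto.const_mul _ ((Complex.continuous_ofReal.tendsto _).comp ?_)
    exact (Real.continuousAt_log (norm_ne_zero_iff.2 h2)).tendsto.comp h1.norm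

omit hH hdom in
theorem memLp_inv_limit (hγ : ∀ n, ‖schurParam σ n‖ < 1) :
    MemLp (fun ξ => (L ξ)⁻¹) 2 circleMeasure := by
  have hLm : AEStronglyMeasurable (fun ξ => (L ξ)⁻¹) circleMeasure :=
    (aestronglyMeasurable_limit σ hL).aemeasurable.inv.aestronglyMeasurable
  refine (memLp_two_iff_integrable_sq_norm hLm).2 ?_
  refine (Measure.integrable_toReal_rnDeriv (μ := σ) (ν := circleMeasure)).congr ?_
  filter_upwards [acDensity_eq_inv_norm_sq σ hσ hL hL0 hγ] with ξ h1
  rw [norm_inv, inv_pow, ← h1]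
  rfl

/-- The function $1/\phi_n^*$ is the Poisson integral of its boundary values. These have norm $1$ in
$L^2(m)$, the Bernstein–Szegő mass being $1$, so a.e. convergence upgrades to $L^1$ and the Poisson
integrals converge too. -/
theorem szegoFunction_eq_poissonIntegral (hγ : ∀ n, ‖schurParam σ n‖ < 1) {z : ℂ}
    (hz : ‖z‖ < 1) :
    szegoFunction σ z = ∫ ξ : Circle, poissonKernel 0 z ξ • (L ξ)⁻¹ ∂circleMeasure := by
  have hc : ∀ n, Continuous fun ξ : Circle =>
      ((starPoly n (orthonormalOPUC σ n)).eval (ξ : ℂ))⁻¹ := fun n =>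
    (continuous_eval_circle _).inv₀ (eval_starPoly_orthonormalOPUC_ne_zero σ hσ n)
  have hmem : ∀ n, MemLp (fun ξ : Circle => ((starPoly n (orthonormalOPUC σ n)).eval (ξ : ℂ))⁻¹) 2
      circleMeasure := fun n =>
    (memLp_two_iff_integrable_sq_norm (hc n).aestronglyMeasurable).2
      ((hc n).norm.pow 2).integrable_circle
  have hv := memLp_inv_limit σ hσ hL hL0 hγ
  have hsq : ∀ n, ∫ ξ : Circle, ‖((starPoly n (orthonormalOPUC σ n)).eval (ξ : ℂ))⁻¹‖ ^ 2
      ∂circleMeasure ≤ 1 := fun n => by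
    have := isProbabilityMeasure_bernsteinSzego σ hσ hγ n
    have h1 := integral_bernsteinSzego σ hσ n fun _ => (1 : ℝ)
    simp only [integral_const, probReal_univ, smul_eq_mul, mul_one] at h1
    simp_rw [norm_inv, inv_pow]
    exact h1.symm.le
  have h1 := tendsto_integral_norm_sub_of_sq_bounded hmem hv hsq (by
    filter_upwards [hL, hL0] with ξ h1 h2
    exact h1.inv₀ h2)
  have h2 := tendsto_integral_continuous_smul (fun n => (hmem n).integrable one_le_two)
    (hv.integrable one_le_two) h1 (continuous_poissonKernel_circle hz)
  have h3 : ∀ n, ∫ ξ : Circle, poissonKernel 0 z ξ •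
      ((starPoly n (orthonormalOPUC σ n)).eval (ξ : ℂ))⁻¹ ∂circleMeasure
        = ((starPoly n (orthonormalOPUC σ n)).eval z)⁻¹ := fun n => by
    obtain ⟨h, h1, -, h3⟩ := exists_log_starPoly_orthonormalOPUC σ hσ n
    have hd : DiffContOnCl ℂ (fun z => Complex.exp (-h z)) (Metric.ball 0 1) :=
      (Complex.differentiable_exp.diffContOnCl (s := Set.univ)).comp h1.neg (Set.mapsTo_univ _ _)
    have h4 := hd.integral_poissonKernel hz
    rw [← h3 z hz.le, ← Complex.exp_neg, ← h4]
    congr 1; ext ξ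
    rw [← h3 ξ (Circle.norm_coe ξ).le, ← Complex.exp_neg]
  simp_rw [h3] at h2
  exact tendsto_nhds_unique (tendsto_inv_eval_szegoFunction σ hσ hL hL0 hH hdom hγ hz) h2

/-- The Szegő function has radial limits `L⁻¹` almost everywhere. -/
theorem ae_isSzegoBoundaryValue (hγ : ∀ n, ‖schurParam σ n‖ < 1) :
    ∀ᵐ ξ ∂circleMeasure, IsSzegoBoundaryValue σ ξ (L ξ)⁻¹ := by
  filter_upwards [ae_tendsto_poissonIntegral
    ((memLp_inv_limit σ hσ hL hL0 hγ).integrable one_le_two)] with ξ h1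
  refine h1.congr' ?_
  filter_upwards [Ioo_mem_nhdsLT (zero_lt_one' ℝ)] with r hr
  exact (szegoFunction_eq_poissonIntegral σ hσ hL hL0 hH hdom hγ
    (norm_radial_lt_one hr.1.le hr.2 ξ)).symm

end Boundary

/-! ### Products of transfer matrices -/

theorem inv_sqrt_mul_inv_sqrt {g : ℂ} (hg : ‖g‖ < 1) :
    ((Real.sqrt (1 - ‖g‖ ^ 2) : ℝ) : ℂ)⁻¹ * ((Real.sqrt (1 - ‖g‖ ^ 2) : ℝ) : ℂ)⁻¹
      * (1 - g * conj g) = 1 := by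
  have h1 : 0 < 1 - ‖g‖ ^ 2 := by nlinarith [norm_nonneg g]
  have h2 : g * conj g = ((‖g‖ ^ 2 : ℝ) : ℂ) := by
    rw [Complex.mul_conj, Complex.normSq_eq_norm_sq]
  have h3 : ((Real.sqrt (1 - ‖g‖ ^ 2) : ℝ) : ℂ) * ((Real.sqrt (1 - ‖g‖ ^ 2) : ℝ) : ℂ)
      = ((1 - ‖g‖ ^ 2 : ℝ) : ℂ) := by
    rw [← Complex.ofReal_mul, Real.mul_self_sqrt h1.le]
  have h4 : ((1 - ‖g‖ ^ 2 : ℝ) : ℂ) ≠ 0 := by exact_mod_cast h1.ne'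
  rw [← mul_inv, h3, h2, ← Complex.ofReal_one, ← Complex.ofReal_sub, inv_mul_cancel₀ h4,
    Complex.ofReal_one]

/-- Membership in the group $SU(1,1)$. It passes to products, so only the first row has to be
followed. -/
theorem transferMatrix_structure {γ : ℕ → ℂ} {n : ℕ} (hγ : ‖γ n‖ < 1) (ξ : Circle) :
    transferMatrix γ n ξ 1 0 = conj (transferMatrix γ n ξ 0 1) ∧
    transferMatrix γ n ξ 1 1 = conj (transferMatrix γ n ξ 0 0) ∧
    transferMatrix γ n ξ 0 0 * conj (transferMatrix γ n ξ 0 0)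
      - transferMatrix γ n ξ 0 1 * conj (transferMatrix γ n ξ 0 1) = 1 := by
  have h := inv_sqrt_mul_inv_sqrt hγ
  have hξ := Circle.coe_ne_zero ξ
  simp only [transferMatrix, Matrix.smul_apply, Matrix.of_apply, Matrix.cons_val',
    Matrix.cons_val_zero, Matrix.cons_val_one, Matrix.cons_val_fin_one, smul_eq_mul, map_mul, map_inv₀, map_pow,
    Complex.conj_ofReal, Complex.conj_conj, Circle.conj_coe, mul_one, inv_pow, inv_inv]
  refine ⟨trivial, trivial, ?_⟩
  rw [← h]
  field_simp

theorem transferProd_structure {γ : ℕ → ℂ} (hγ : ∀ n, ‖γ n‖ < 1) (n : ℕ) (ξ : Circle) :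
    transferProd γ n ξ 1 0 = conj (transferProd γ n ξ 0 1) ∧
    transferProd γ n ξ 1 1 = conj (transferProd γ n ξ 0 0) ∧
    transferProd γ n ξ 0 0 * conj (transferProd γ n ξ 0 0)
      - transferProd γ n ξ 0 1 * conj (transferProd γ n ξ 0 1) = 1 := by
  induction n with
  | zero => exact transferMatrix_structure (hγ 0) ξ
  | succ n ih =>
    obtain ⟨h1, h2, h3⟩ := ih
    obtain ⟨t1, t2, t3⟩ := transferMatrix_structure (hγ (n + 1)) ξ
    simp only [transferProd, Matrix.mul_apply, Fin.sum_univ_two, h1, h2, t1, t2, map_add, map_mul,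
      Complex.conj_conj]
    refine ⟨by ring, by ring, ?_⟩
    linear_combination t3 + h3 * (transferMatrix γ (n + 1) ξ 0 0
      * conj (transferMatrix γ (n + 1) ξ 0 0)
      - transferMatrix γ (n + 1) ξ 0 1 * conj (transferMatrix γ (n + 1) ξ 0 1))

theorem norm_sq_sub_norm_sq_transferProd {γ : ℕ → ℂ} (hγ : ∀ n, ‖γ n‖ < 1) (n : ℕ) (ξ : Circle) :
    ‖transferProd γ n ξ 0 0‖ ^ 2 - ‖transferProd γ n ξ 0 1‖ ^ 2 = 1 := by
  have h := (transferProd_structure hγ n ξ).2.2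
  rw [Complex.mul_conj, Complex.mul_conj, Complex.normSq_eq_norm_sq,
    Complex.normSq_eq_norm_sq] at h
  exact_mod_cast h

theorem frobNorm_sq (M : Matrix (Fin 2) (Fin 2) ℂ) :
    frobNorm M ^ 2 = ‖M 0 0‖ ^ 2 + ‖M 1 0‖ ^ 2 + ‖M 0 1‖ ^ 2 + ‖M 1 1‖ ^ 2 := by
  have h : (Matrix.trace (Mᴴ * M)).re
      = ‖M 0 0‖ ^ 2 + ‖M 1 0‖ ^ 2 + ‖M 0 1‖ ^ 2 + ‖M 1 1‖ ^ 2 := by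
    simp only [Matrix.trace, Matrix.diag, Matrix.mul_apply, Matrix.conjTranspose_apply,
      Fin.sum_univ_two, RCLike.star_def, ← Complex.normSq_eq_conj_mul_self,
      Complex.normSq_eq_norm_sq]
    rw [← Complex.ofReal_add, ← Complex.ofReal_add, ← Complex.ofReal_add, Complex.ofReal_re]
    ring
  rw [frobNorm, h, Real.sq_sqrt (by positivity)]

/-- For a matrix in $SU(1,1)$ with first row $(a,b)$ the squared Frobenius distance to $I$ is
$2(|a-1|^2+|b|^2)\ge(|a-1|+|b|)^2$. -/
theorem norm_sub_one_add_norm_le_frobNorm {γ : ℕ → ℂ} (hγ : ∀ n, ‖γ n‖ < 1) (n : ℕ) (ξ : Circle) :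
    ‖transferProd γ n ξ 0 0 - 1‖ + ‖transferProd γ n ξ 0 1‖
      ≤ frobNorm (transferProd γ n ξ - 1) := by
  obtain ⟨h1, h2, -⟩ := transferProd_structure hγ n ξ
  have h := frobNorm_sq (transferProd γ n ξ - 1)
  simp only [Matrix.sub_apply, Matrix.one_apply_eq, ne_eq, zero_ne_one, one_ne_zero,
    not_false_eq_true, Matrix.one_apply_ne, sub_zero, h1, h2] at h
  have hc : ‖conj (transferProd γ n ξ 0 0) - 1‖ = ‖transferProd γ n ξ 0 0 - 1‖ := by
    rw [← Complex.norm_conj, map_sub, Complex.conj_conj, map_one]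
  rw [hc, Complex.norm_conj] at h
  refine (abs_le_of_sq_le_sq' ?_ (show 0 ≤ frobNorm _ from Real.sqrt_nonneg _)).2
  rw [h]
  nlinarith [sq_nonneg (‖transferProd γ n ξ 0 0 - 1‖ - ‖transferProd γ n ξ 0 1‖)]

theorem continuous_transferProd (γ : ℕ → ℂ) (n : ℕ) : Continuous (transferProd γ n) := by
  have hm : ∀ n, Continuous (transferMatrix γ n) := fun n => by
    have hp : Continuous fun ξ : Circle => (ξ : ℂ) ^ n := continuous_subtype_val.pow n
    have hi : Continuous fun ξ : Circle => ((ξ : ℂ) ^ n)⁻¹ :=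
      hp.inv₀ fun ξ => pow_ne_zero _ (Circle.coe_ne_zero ξ)
    have hM : Continuous fun ξ : Circle => (!![1, conj (γ n) * ((ξ : ℂ) ^ n)⁻¹;
        γ n * (ξ : ℂ) ^ n, 1] : Matrix (Fin 2) (Fin 2) ℂ) := by
      refine continuous_matrix fun i j => ?_
      fin_cases i <;> fin_cases j
      · exact continuous_const
      · exact continuous_const.mul hi
      · exact continuous_const.mul hp
      · exact continuous_const
    exact hM.const_smul ((Real.sqrt (1 - ‖γ n‖ ^ 2) : ℝ) : ℂ)⁻¹
  induction n with
  | zero => exact hm 0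
  | succ n ih => exact (hm (n + 1)).matrix_mul ih

theorem continuous_frobNorm : Continuous frobNorm :=
  Real.continuous_sqrt.comp (Complex.continuous_re.comp
    ((continuous_id.matrix_conjTranspose.matrix_mul continuous_id).matrix_trace))

theorem measurable_maximalO (γ : ℕ → ℂ) : Measurable (maximalO γ) :=
  Measurable.iSup fun n => (continuous_frobNorm.comp
    ((continuous_transferProd γ n).sub continuous_const)).measurable.ennreal_ofReal

/-- The integrand `log (1 + O²)`. -/
noncomputable def logMaximal (γ : ℕ → ℂ) (ξ : Circle) : ℝ≥0∞ :=
  (ENNReal.log (1 + maximalO γ ξ ^ 2)).toENNReal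

theorem measurable_logMaximal (γ : ℕ → ℂ) : Measurable (logMaximal γ) :=
  (ENNReal.measurable_log.comp (((measurable_maximalO γ).pow_const 2).const_add 1)).ereal_toENNReal

theorem log_one_add_sq_le_logMaximal {γ : ℕ → ℂ} {ξ : Circle} {t : ℝ} (ht : 0 ≤ t)
    (h : ENNReal.ofReal t ≤ maximalO γ ξ) :
    ENNReal.ofReal (Real.log (1 + t ^ 2)) ≤ logMaximal γ ξ := by
  have h1 : ENNReal.ofReal (1 + t ^ 2) ≤ 1 + maximalO γ ξ ^ 2 := by
    rw [ENNReal.ofReal_add zero_le_one (by positivity), ENNReal.ofReal_one, ENNReal.ofReal_pow ht]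
    gcongr
  have h2 := EReal.toENNReal_le_toENNReal (ENNReal.log_monotone h1)
  rw [ENNReal.log_ofReal_of_pos (by positivity)] at h2
  exact h2

theorem norm_sub_one_add_norm_le_of_logMaximal_lt {γ : ℕ → ℂ} (hγ : ∀ n, ‖γ n‖ < 1) {ξ : Circle}
    {t : ℝ} (ht : 0 ≤ t) (h : logMaximal γ ξ < ENNReal.ofReal (Real.log (1 + t ^ 2))) (n : ℕ) :
    ‖transferProd γ n ξ 0 0 - 1‖ + ‖transferProd γ n ξ 0 1‖ ≤ t := by
  by_contra hlt
  push Not at hlt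
  refine absurd (log_one_add_sq_le_logMaximal ht (le_trans ?_
    (le_iSup (fun n => ENNReal.ofReal (frobNorm (transferProd γ n ξ - 1))) n))) (not_le.2 h)
  exact ENNReal.ofReal_le_ofReal (hlt.le.trans (norm_sub_one_add_norm_le_frobNorm hγ n ξ))

theorem log_norm_add_norm_le_logMaximal {γ : ℕ → ℂ} (hγ : ∀ n, ‖γ n‖ < 1) {ξ : Circle}
    (h : logMaximal γ ξ ≠ ∞) (n : ℕ) :
    Real.log (‖transferProd γ n ξ 0 0‖ + ‖transferProd γ n ξ 0 1‖)
      ≤ 1 + (logMaximal γ ξ).toReal := by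
  set t := ‖transferProd γ n ξ 0 0 - 1‖ + ‖transferProd γ n ξ 0 1‖ with ht
  have ht0 : 0 ≤ t := by positivity
  have h1 := log_one_add_sq_le_logMaximal (γ := γ) (ξ := ξ) ht0 (le_trans
    (ENNReal.ofReal_le_ofReal (norm_sub_one_add_norm_le_frobNorm hγ n ξ))
    (le_iSup (fun n => ENNReal.ofReal (frobNorm (transferProd γ n ξ - 1))) n))
  have h2 := (ENNReal.ofReal_le_iff_le_toReal h).1 h1
  have h3 := norm_sq_sub_norm_sq_transferProd hγ n ξ
  have h4 : ‖transferProd γ n ξ 0 0‖ ≤ 1 + ‖transferProd γ n ξ 0 0 - 1‖ := by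
    have := norm_add_le 1 (transferProd γ n ξ 0 0 - 1)
    rwa [add_sub_cancel, norm_one] at this
  have h5 : 0 < ‖transferProd γ n ξ 0 0‖ := by
    by_contra h0
    have h0' : ‖transferProd γ n ξ 0 0‖ = 0 := le_antisymm (not_lt.1 h0) (norm_nonneg _)
    rw [h0'] at h3
    nlinarith [sq_nonneg ‖transferProd γ n ξ 0 1‖]
  -- The sum is at most $1+t\le2(1+t^2)$, and the additive $1$ in the bound absorbs $\log2$.
  calc Real.log (‖transferProd γ n ξ 0 0‖ + ‖transferProd γ n ξ 0 1‖)
      ≤ Real.log (2 * (1 + t ^ 2)) := by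
        refine Real.log_le_log (by positivity) ?_
        nlinarith [sq_nonneg (t - 1)]
    _ = Real.log 2 + Real.log (1 + t ^ 2) := Real.log_mul two_ne_zero (by positivity)
    _ ≤ 1 + (logMaximal γ ξ).toReal := add_le_add (by linarith [Real.log_two_lt_d9]) h2

/-! ### Tails of the coefficient sequence -/

theorem transferMatrix_congr {γ δ : ℕ → ℂ} {n : ℕ} (h : γ n = δ n) (ξ : Circle) :
    transferMatrix γ n ξ = transferMatrix δ n ξ := by
  rw [transferMatrix, transferMatrix, h]

theorem transferMatrix_eq_one {γ : ℕ → ℂ} {n : ℕ} (h : γ n = 0) (ξ : Circle) :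
    transferMatrix γ n ξ = 1 := by
  rw [transferMatrix, h]
  simp [← Matrix.one_fin_two]

theorem transferProd_eq_one {γ : ℕ → ℂ} {N : ℕ} (h : ∀ n ≤ N, γ n = 0) (ξ : Circle) :
    transferProd γ N ξ = 1 := by
  induction N with
  | zero => exact transferMatrix_eq_one (h 0 le_rfl) ξ
  | succ N ih =>
    rw [transferProd, ih fun n hn => h n (hn.trans N.le_succ),
      transferMatrix_eq_one (h _ le_rfl), mul_one]

theorem transferProd_eq_tail_mul {γ δ : ℕ → ℂ} {N : ℕ} (h0 : ∀ n ≤ N, δ n = 0)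
    (h1 : ∀ n, N < n → δ n = γ n) (ξ : Circle) {n : ℕ} (hn : N ≤ n) :
    transferProd γ n ξ = transferProd δ n ξ * transferProd γ N ξ := by
  induction n, hn using Nat.le_induction with
  | base => rw [transferProd_eq_one h0, one_mul]
  | succ n hn ih =>
    rw [transferProd, transferProd, ih, transferMatrix_congr (h1 (n + 1) (by omega)), mul_assoc]

/-- The tail of a square-summable sequence, vanishing up to the index `N`. -/
noncomputable def lpTail (γ : lp (fun _ : ℕ => ℂ) 2) (N : ℕ) : lp (fun _ : ℕ => ℂ) 2 :=
  γ - ∑ i ∈ Finset.range (N + 1), lp.single 2 i (γ i)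

theorem lpTail_apply (γ : lp (fun _ : ℕ => ℂ) 2) (N n : ℕ) :
    lpTail γ N n = if n ≤ N then 0 else γ n := by
  rw [lpTail, lp.coeFn_sub, lp.coeFn_sum, Pi.sub_apply, Finset.sum_apply]
  simp only [lp.single_apply, Pi.single_apply, Finset.sum_ite_eq, Finset.mem_range,
    Nat.lt_succ_iff]
  split_ifs <;> simp

theorem tendsto_norm_lpTail (γ : lp (fun _ : ℕ => ℂ) 2) :
    Tendsto (fun N => ‖lpTail γ N‖) atTop (𝓝 0) := by
  have h := (lp.hasSum_single (p := 2) (by simp) γ).tendsto_sum_nat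
  have h2 := ((h.comp (tendsto_add_atTop_nat 1)).const_sub γ).norm
  rwa [sub_self, norm_zero] at h2

theorem norm_lpTail_lt_one {γ : lp (fun _ : ℕ => ℂ) 2} (hγ : ∀ n, ‖γ n‖ < 1) (N n : ℕ) :
    ‖lpTail γ N n‖ < 1 := by
  rw [lpTail_apply]
  split_ifs
  · simp
  · exact hγ n

theorem transferProd_eq_lpTail_mul (γ : lp (fun _ : ℕ => ℂ) 2) {N n : ℕ} (hn : N ≤ n)
    (ξ : Circle) :
    transferProd γ n ξ = transferProd (lpTail γ N) n ξ * transferProd γ N ξ :=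
  transferProd_eq_tail_mul (fun k hk => by rw [lpTail_apply, if_pos hk])
    (fun k hk => by rw [lpTail_apply, if_neg (not_le.2 hk)]) ξ hn

theorem tendsto_lintegral_logMaximal_lpTail (hconj : QNCCII) {γ : lp (fun _ : ℕ => ℂ) 2}
    (hγ : ∀ n, ‖γ n‖ < 1) :
    Tendsto (fun N => ∫⁻ ξ, logMaximal (lpTail γ N) ξ ∂circleMeasure) atTop (𝓝 0) := by
  obtain ⟨ε, hε, C, hC⟩ := hconj
  have h := tendsto_norm_lpTail γ
  have h1 : Tendsto (fun N => ENNReal.ofReal (C * ‖lpTail γ N‖ ^ 2)) atTop (𝓝 0) := by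
    have := ENNReal.tendsto_ofReal ((h.pow 2).const_mul C)
    simpa using this
  refine tendsto_of_tendsto_of_tendsto_of_le_of_le' tendsto_const_nhds h1
    (Eventually.of_forall fun _ => zero_le) ?_
  filter_upwards [h.eventually (ge_mem_nhds hε)] with N hN
  exact hC _ (norm_lpTail_lt_one hγ N) hN

/-- Smallness in $L^1$ does not give a.e. convergence in `N`, but the infimum over $N\ge N_0$ has
integral zero and hence vanishes a.e. Having some good `N` beyond every `N₀` is enough. -/
theorem ae_exists_logMaximal_lpTail_lt (hconj : QNCCII) {γ : lp (fun _ : ℕ => ℂ) 2}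
    (hγ : ∀ n, ‖γ n‖ < 1) :
    ∀ᵐ ξ ∂circleMeasure, ∀ N₀ : ℕ, ∀ ε : ℝ≥0∞, ε ≠ 0 →
      ∃ N ≥ N₀, logMaximal (lpTail γ N) ξ < ε := by
  refine ae_all_iff.2 fun N₀ => ?_
  have hlim := tendsto_lintegral_logMaximal_lpTail hconj hγ
  have hz : ∫⁻ ξ, ⨅ k : ℕ, logMaximal (lpTail γ (N₀ + k)) ξ ∂circleMeasure = 0 := by
    refine le_antisymm (ge_of_tendsto hlim (eventually_atTop.2 ⟨N₀, fun N hN => ?_⟩)) zero_le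
    obtain ⟨k, rfl⟩ := Nat.exists_eq_add_of_le hN
    exact lintegral_mono fun ξ => iInf_le _ k
  rw [lintegral_eq_zero_iff (Measurable.iInf fun k => measurable_logMaximal _)] at hz
  filter_upwards [hz] with ξ hξ ε hε
  obtain ⟨k, hk⟩ := iInf_lt_iff.1 (show (⨅ k : ℕ, logMaximal (lpTail γ (N₀ + k)) ξ) < ε by
    rw [hξ]; exact pos_iff_ne_zero.2 hε)
  exact ⟨N₀ + k, Nat.le_add_right _ _, hk⟩

theorem ae_exists_transferProd_lpTail_near (hconj : QNCCII) {γ : lp (fun _ : ℕ => ℂ) 2}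
    (hγ : ∀ n, ‖γ n‖ < 1) :
    ∀ᵐ ξ ∂circleMeasure, ∀ N₀ : ℕ, ∀ ε : ℝ, 0 < ε → ∃ N ≥ N₀, ∀ n,
      ‖transferProd (lpTail γ N) n ξ 0 0 - 1‖ + ‖transferProd (lpTail γ N) n ξ 0 1‖ ≤ ε := by
  filter_upwards [ae_exists_logMaximal_lpTail_lt hconj hγ] with ξ hξ N₀ ε hε
  obtain ⟨N, hN, h⟩ := hξ N₀ (ENNReal.ofReal (Real.log (1 + ε ^ 2))) (by
    have : 0 < Real.log (1 + ε ^ 2) := Real.log_pos (by nlinarith)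
    simpa using this)
  exact ⟨N, hN, norm_sub_one_add_norm_le_of_logMaximal_lt (norm_lpTail_lt_one hγ N) hε.le h⟩

/-- A good tail controls $\Pi_n-\Pi_N$ only relative to the size of $\Pi_N$. One tail with error $1$
first bounds all later products, after which the relative estimate becomes a Cauchy estimate. -/
theorem exists_tendsto_transferProd {γ : lp (fun _ : ℕ => ℂ) 2} (hγ : ∀ n, ‖γ n‖ < 1)
    {ξ : Circle} (h : ∀ N₀ : ℕ, ∀ ε : ℝ, 0 < ε → ∃ N ≥ N₀, ∀ n,
      ‖transferProd (lpTail γ N) n ξ 0 0 - 1‖ + ‖transferProd (lpTail γ N) n ξ 0 1‖ ≤ ε) :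
    ∃ L : Matrix (Fin 2) (Fin 2) ℂ, Tendsto (fun n => transferProd γ n ξ) atTop (𝓝 L) := by
  have key : ∀ j : Fin 2, ∀ N n, N ≤ n → ∀ ε : ℝ,
      ‖transferProd (lpTail γ N) n ξ 0 0 - 1‖ + ‖transferProd (lpTail γ N) n ξ 0 1‖ ≤ ε →
      ∀ i, ‖transferProd γ n ξ i j - transferProd γ N ξ i j‖
        ≤ ε * (‖transferProd γ N ξ 0 j‖ + ‖transferProd γ N ξ 1 j‖) := by
    intro j N n hn ε hε i
    obtain ⟨h1, h2, -⟩ := transferProd_structure (norm_lpTail_lt_one hγ N) n ξ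
    rw [transferProd_eq_lpTail_mul γ hn, Matrix.mul_apply, Fin.sum_univ_two]
    set A := transferProd (lpTail γ N) n ξ 0 0
    set B := transferProd (lpTail γ N) n ξ 0 1
    set p := transferProd γ N ξ 0 j
    set q := transferProd γ N ξ 1 j
    have hA : ‖A - 1‖ ≤ ε := by linarith [norm_nonneg B]
    have hB : ‖B‖ ≤ ε := by linarith [norm_nonneg (A - 1)]
    have hA' : ‖conj A - 1‖ ≤ ε := by rwa [← map_one conj, ← map_sub, Complex.norm_conj]
    have hB' : ‖conj B‖ ≤ ε := by rwa [Complex.norm_conj]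
    fin_cases i
    · change ‖A * p + B * q - p‖ ≤ _
      calc ‖A * p + B * q - p‖ = ‖(A - 1) * p + B * q‖ := by congr 1; ring
        _ ≤ ‖A - 1‖ * ‖p‖ + ‖B‖ * ‖q‖ := (norm_add_le _ _).trans (by rw [norm_mul, norm_mul])
        _ ≤ ε * ‖p‖ + ε * ‖q‖ := by gcongr
        _ = _ := by ring
    · change ‖transferProd (lpTail γ N) n ξ 1 0 * p
        + transferProd (lpTail γ N) n ξ 1 1 * q - q‖ ≤ _
      rw [h1, h2]
      calc ‖conj B * p + conj A * q - q‖ = ‖conj B * p + (conj A - 1) * q‖ := by congr 1; ring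
        _ ≤ ‖conj B‖ * ‖p‖ + ‖conj A - 1‖ * ‖q‖ :=
          (norm_add_le _ _).trans (by rw [norm_mul, norm_mul])
        _ ≤ ε * ‖p‖ + ε * ‖q‖ := by gcongr
        _ = _ := by ring
  have hcol : ∀ j : Fin 2, ∀ i, ∃ l, Tendsto (fun n => transferProd γ n ξ i j) atTop (𝓝 l) := by
    intro j i
    obtain ⟨N₁, -, hN₁⟩ := h 0 1 one_pos
    set s := ‖transferProd γ N₁ ξ 0 j‖ + ‖transferProd γ N₁ ξ 1 j‖ with hs
    have hs0 : 0 ≤ s := by positivity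
    -- Each of the two entries of the column moves by at most `s`, and their norms sum to `s` at the
    -- start.
    have hbound : ∀ n ≥ N₁, ‖transferProd γ n ξ 0 j‖ + ‖transferProd γ n ξ 1 j‖ ≤ 3 * s := by
      intro n hn
      have h0 := key j N₁ n hn 1 (hN₁ n) 0
      have h1 := key j N₁ n hn 1 (hN₁ n) 1
      have h2 := norm_le_norm_add_norm_sub (transferProd γ N₁ ξ 0 j) (transferProd γ n ξ 0 j)
      have h3 := norm_le_norm_add_norm_sub (transferProd γ N₁ ξ 1 j) (transferProd γ n ξ 1 j)
      rw [norm_sub_rev] at h2 h3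
      linarith
    refine cauchySeq_tendsto_of_complete (Metric.cauchySeq_iff'.2 fun ε hε => ?_)
    -- The added $1$ keeps the denominator positive when `s` is zero.
    obtain ⟨N, hN, hN'⟩ := h N₁ (ε / (3 * s + 1)) (by positivity)
    refine ⟨N, fun n hn => ?_⟩
    rw [dist_eq_norm]
    refine (key j N n hn _ (hN' n) i).trans_lt ?_
    have := hbound N hN
    calc ε / (3 * s + 1) * (‖transferProd γ N ξ 0 j‖ + ‖transferProd γ N ξ 1 j‖)
        ≤ ε / (3 * s + 1) * (3 * s) := by gcongr
      _ < ε := by rw [div_mul_eq_mul_div, div_lt_iff₀ (by positivity)]; nlinarith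
  choose l hl using hcol
  exact ⟨Matrix.of fun i j => l j i,
    tendsto_pi_nhds.2 fun i => tendsto_pi_nhds.2 fun j => hl j i⟩

/-! ### Orthogonal polynomials and transfer matrices -/

section OPUCTransfer

variable (σ : Measure Circle) [IsProbabilityMeasure σ] (hσ : σ.support.Infinite) {γ : ℕ → ℂ}
  (hγ : ∀ n, ‖γ n‖ < 1) (hs : ∀ n, schurParam σ n = γ n)

include hσ hγ hs

/-- On the circle $\phi_n=\xi^n\overline{\phi_n^*}$, so the recursion closes up in $\phi_n^*$ alone.
-/
theorem eval_starPoly_orthonormalOPUC_succ (n : ℕ) (ξ : Circle) :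
    (starPoly (n + 1) (orthonormalOPUC σ (n + 1))).eval (ξ : ℂ) =
      ((Real.sqrt (1 - ‖γ n‖ ^ 2) : ℝ) : ℂ)⁻¹ *
        ((starPoly n (orthonormalOPUC σ n)).eval (ξ : ℂ)
          - γ n * (ξ : ℂ) ^ (n + 1) * conj ((starPoly n (orthonormalOPUC σ n)).eval (ξ : ℂ))) := by
  have hN : monicNormSq σ (n + 1) = (1 - ‖γ n‖ ^ 2) * monicNormSq σ n := by
    rw [← hs]; exact integral_norm_sq_monicOPUC_succ σ hσ n
  have h1 : 0 ≤ 1 - ‖γ n‖ ^ 2 := by nlinarith [norm_nonneg (γ n), hγ n]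
  have hξ := Circle.coe_ne_zero ξ
  rw [eval_starPoly_orthonormalOPUC, eval_starPoly_orthonormalOPUC, hN, Real.sqrt_mul h1,
    starPoly_monicOPUC_succ σ hσ, hs]
  simp only [eval_sub, eval_mul, eval_C, eval_X,
    eval_starPoly_circle (natDegree_monicOPUC σ hσ n).le, map_mul, map_inv₀, Complex.conj_ofReal,
    map_pow, Circle.conj_coe, Complex.conj_conj, Complex.ofReal_mul, mul_inv, inv_pow]
  field_simp
  ring

/-- The matrix $\Omega_n$ sends the vector $(\overline{\phi_n^*},\,-\xi^{-1}\phi_n^*)$ to the same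
vector with $n+1$ in place of $n$. The starting value `x` and the coefficients `δ` are left free to
serve both the full product, with $x=\phi_0^*=1$, and a tail product, with $x=\phi_{N+1}^*$. -/
theorem conj_eval_starPoly_eq {N : ℕ} (ξ : Circle) {δ : ℕ → ℂ} (hδ : ∀ n, ‖δ n‖ < 1)
    (hδγ : ∀ n, N < n → δ n = γ n) {x : ℂ}
    (hx : conj ((starPoly (N + 1) (orthonormalOPUC σ (N + 1))).eval (ξ : ℂ)) =
      transferProd δ N ξ 0 0 * conj x - transferProd δ N ξ 0 1 * ((ξ : ℂ)⁻¹ * x))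
    {n : ℕ} (hn : N ≤ n) :
    conj ((starPoly (n + 1) (orthonormalOPUC σ (n + 1))).eval (ξ : ℂ)) =
      transferProd δ n ξ 0 0 * conj x - transferProd δ n ξ 0 1 * ((ξ : ℂ)⁻¹ * x) := by
  induction n, hn using Nat.le_induction with
  | base => exact hx
  | succ n hn ih =>
    have ih' := congrArg conj ih
    have hξ := Circle.coe_ne_zero ξ
    obtain ⟨h1, h2, -⟩ := transferProd_structure hδ n ξ
    rw [Complex.conj_conj] at ih'
    rw [eval_starPoly_orthonormalOPUC_succ σ hσ hγ hs, transferProd,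
      transferMatrix_congr (hδγ (n + 1) (by omega))]
    simp only [map_mul, map_sub, map_inv₀, map_pow, Complex.conj_ofReal, Complex.conj_conj,
      Circle.conj_coe, inv_inv] at ih' ⊢
    rw [ih, ih']
    simp only [Matrix.mul_apply, Fin.sum_univ_two, h1, h2, transferMatrix,
      Matrix.smul_apply, Matrix.of_apply, Matrix.cons_val', Matrix.cons_val_zero,
      Matrix.cons_val_one, Matrix.cons_val_fin_one, smul_eq_mul, inv_pow]
    field_simp
    ring

omit hγ hs in
theorem eval_starPoly_orthonormalOPUC_zero (z : ℂ) :
    (starPoly 0 (orthonormalOPUC σ 0)).eval z = 1 := by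
  have h : monicOPUC σ 0 = 1 := by rw [monicOPUC]; simp
  rw [eval_starPoly_orthonormalOPUC, monicNormSq, eval_starPoly_monicOPUC_eq_prod σ hσ, h]
  simp

theorem conj_eval_starPoly_succ_eq (ξ : Circle) (n : ℕ) :
    conj ((starPoly (n + 1) (orthonormalOPUC σ (n + 1))).eval (ξ : ℂ)) =
      transferProd γ n ξ 0 0 - transferProd γ n ξ 0 1 * (ξ : ℂ)⁻¹ := by
  have h := conj_eval_starPoly_eq σ hσ hγ hs (N := 0) ξ hγ (fun _ _ => rfl) (x := 1) ?_ n.zero_le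
  · simpa using h
  · rw [eval_starPoly_orthonormalOPUC_succ σ hσ hγ hs,
      eval_starPoly_orthonormalOPUC_zero σ hσ]
    simp [transferProd, transferMatrix, Circle.conj_coe]
    ring

/-- The relation $|a|^2-|b|^2=1$ survives in the limit and forces $a\ne b\xi^{-1}$. -/
theorem exists_limit_starPoly {ξ : Circle} {M : Matrix (Fin 2) (Fin 2) ℂ}
    (hM : Tendsto (fun n => transferProd γ n ξ) atTop (𝓝 M)) :
    ∃ l : ℂ, l ≠ 0 ∧
      Tendsto (fun n => (starPoly n (orthonormalOPUC σ n)).eval (ξ : ℂ)) atTop (𝓝 l) := by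
  have hentry : ∀ i j, Tendsto (fun n => transferProd γ n ξ i j) atTop (𝓝 (M i j)) := fun i j =>
    tendsto_pi_nhds.1 (tendsto_pi_nhds.1 hM i) j
  have hdet : ‖M 0 0‖ ^ 2 - ‖M 0 1‖ ^ 2 = 1 := by
    have h1 := ((hentry 0 0).norm.pow 2).sub ((hentry 0 1).norm.pow 2)
    simp_rw [norm_sq_sub_norm_sq_transferProd hγ] at h1
    exact tendsto_nhds_unique h1 tendsto_const_nhds
  refine ⟨conj (M 0 0 - M 0 1 * (ξ : ℂ)⁻¹), fun h0 => ?_, ?_⟩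
  · have h1 : M 0 0 = M 0 1 * (ξ : ℂ)⁻¹ := sub_eq_zero.1 ((map_eq_zero _).1 h0)
    rw [h1, norm_mul, norm_inv, Circle.norm_coe, inv_one, mul_one, sub_self] at hdet
    exact zero_ne_one hdet
  · rw [← tendsto_add_atTop_iff_nat 1]
    have h1 := (Complex.continuous_conj.tendsto _).comp
      ((hentry 0 0).sub ((hentry 0 1).mul_const (ξ : ℂ)⁻¹))
    refine h1.congr fun n => ?_
    simp only [Function.comp]
    rw [← conj_eval_starPoly_succ_eq σ hσ hγ hs, Complex.conj_conj]

/-- With $(A,B)$ the first row of the tail product, $(|A|-|B|)|x|\le|y|\le(|A|+|B|)|x|$. Since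
$|A|-|B|=(|A|+|B|)^{-1}$, the same quantity $\log(|A|+|B|)$ bounds $\log|y/x|$ from both sides. The
resulting majorant does not depend on `n`. -/
theorem abs_log_norm_starPoly_le {N : ℕ} (ξ : Circle) {δ : ℕ → ℂ} (hδ : ∀ n, ‖δ n‖ < 1)
    (hδ0 : ∀ n ≤ N, δ n = 0) (hδγ : ∀ n, N < n → δ n = γ n) (hfin : logMaximal δ ξ ≠ ∞)
    {n : ℕ} (hn : N ≤ n) :
    |Real.log ‖(starPoly (n + 1) (orthonormalOPUC σ (n + 1))).eval (ξ : ℂ)‖|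
      ≤ |Real.log ‖(starPoly (N + 1) (orthonormalOPUC σ (N + 1))).eval (ξ : ℂ)‖|
        + (1 + (logMaximal δ ξ).toReal) := by
  have h := conj_eval_starPoly_eq σ hσ hγ hs ξ hδ hδγ
    (x := (starPoly (N + 1) (orthonormalOPUC σ (N + 1))).eval (ξ : ℂ))
    (by rw [transferProd_eq_one hδ0]; simp) hn
  have hlog := log_norm_add_norm_le_logMaximal hδ hfin n
  have hdet := norm_sq_sub_norm_sq_transferProd hδ n ξ
  set A := transferProd δ n ξ 0 0
  set B := transferProd δ n ξ 0 1
  set x := (starPoly (N + 1) (orthonormalOPUC σ (N + 1))).eval (ξ : ℂ) with hx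
  set y := (starPoly (n + 1) (orthonormalOPUC σ (n + 1))).eval (ξ : ℂ) with hy
  have hx0 : 0 < ‖x‖ := norm_pos_iff.2 (eval_starPoly_orthonormalOPUC_ne_zero σ hσ _ ξ)
  have hy0 : 0 < ‖y‖ := norm_pos_iff.2 (eval_starPoly_orthonormalOPUC_ne_zero σ hσ _ ξ)
  have e1 : ‖A * conj x‖ = ‖A‖ * ‖x‖ := by rw [norm_mul, Complex.norm_conj]
  have e2 : ‖B * ((ξ : ℂ)⁻¹ * x)‖ = ‖B‖ * ‖x‖ := by
    rw [norm_mul, norm_mul, norm_inv, Circle.norm_coe, inv_one, one_mul]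
  have h1 : ‖y‖ ≤ (‖A‖ + ‖B‖) * ‖x‖ := by
    rw [← Complex.norm_conj y, h, add_mul, ← e1, ← e2]
    exact norm_sub_le _ _
  have h2 : (‖A‖ - ‖B‖) * ‖x‖ ≤ ‖y‖ := by
    rw [← Complex.norm_conj y, h, sub_mul, ← e1, ← e2]
    exact norm_sub_norm_le _ _
  have hs0 : 0 < ‖A‖ + ‖B‖ := by
    by_contra hle
    have := norm_nonneg A
    have := norm_nonneg B
    have hA : ‖A‖ = 0 := by linarith
    have hB : ‖B‖ = 0 := by linarith
    rw [hA, hB] at hdet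
    norm_num at hdet
  have h3 : ‖x‖ ≤ (‖A‖ + ‖B‖) * ‖y‖ := by
    calc ‖x‖ = (‖A‖ + ‖B‖) * ((‖A‖ - ‖B‖) * ‖x‖) := by linear_combination (-‖x‖) * hdet
      _ ≤ (‖A‖ + ‖B‖) * ‖y‖ := by gcongr
  have h4 := Real.log_le_log hy0 h1
  have h5 := Real.log_le_log hx0 h3
  rw [Real.log_mul hs0.ne' hx0.ne'] at h4
  rw [Real.log_mul hs0.ne' hy0.ne'] at h5
  rw [abs_le]
  constructor
  · linarith [neg_abs_le (Real.log ‖x‖)]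
  · linarith [le_abs_self (Real.log ‖x‖)]

end OPUCTransfer

/-! ### Assembly of the theorem. -/

theorem mainTheorem2 (hconj : QNCCII)
    (γ : lp (fun _ : ℕ => ℂ) 2) (hγ : ∀ n, ‖γ n‖ < 1) :
    (∀ᵐ ξ ∂circleMeasure, ∃ L : Matrix (Fin 2) (Fin 2) ℂ,
      Tendsto (fun n => transferProd γ n ξ) atTop (𝓝 L)) ∧
    ∀ σ : Measure Circle, IsProbabilityMeasure σ → σ.support.Infinite →
      (∀ n, schurParam σ n = γ n) →
      InSzegoClass σ ∧
      ∀ᵐ ξ ∂circleMeasure, ∃ d : ℂ, d ≠ 0 ∧ IsSzegoBoundaryValue σ ξ d ∧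
        Tendsto (fun n => (starPoly n (orthonormalOPUC σ n)).eval (ξ : ℂ)) atTop (𝓝 d⁻¹) := by
  have hconv : ∀ᵐ ξ ∂circleMeasure, ∃ L : Matrix (Fin 2) (Fin 2) ℂ,
      Tendsto (fun n => transferProd γ n ξ) atTop (𝓝 L) := by
    filter_upwards [ae_exists_transferProd_lpTail_near hconj hγ] with ξ hξ
    exact exists_tendsto_transferProd hγ hξ
  refine ⟨hconv, fun σ hσp hσ hs => ?_⟩
  have hs1 : ∀ n, ‖schurParam σ n‖ < 1 := fun n => by rw [hs]; exact hγ n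
  have hlim : ∀ᵐ ξ : Circle ∂circleMeasure, ∃ l : ℂ, l ≠ 0 ∧
      Tendsto (fun n => (starPoly n (orthonormalOPUC σ n)).eval (ξ : ℂ)) atTop (𝓝 l) := by
    filter_upwards [hconv] with ξ ⟨M, hM⟩
    exact exists_limit_starPoly σ hσ hγ hs hM
  classical
  -- The default $0$ is taken only on a null set.
  set L : Circle → ℂ := fun ξ => if h : ∃ l : ℂ, l ≠ 0 ∧
    Tendsto (fun n => (starPoly n (orthonormalOPUC σ n)).eval (ξ : ℂ)) atTop (𝓝 l)
    then h.choose else 0 with hLdef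
  have hL0 : ∀ᵐ ξ ∂circleMeasure, L ξ ≠ 0 := by
    filter_upwards [hlim] with ξ h
    simp only [hLdef, dif_pos h]
    exact h.choose_spec.1
  have hL : ∀ᵐ ξ : Circle ∂circleMeasure,
      Tendsto (fun n => (starPoly n (orthonormalOPUC σ n)).eval (ξ : ℂ)) atTop (𝓝 (L ξ)) := by
    filter_upwards [hlim] with ξ h
    simp only [hLdef, dif_pos h]
    exact h.choose_spec.2
  -- The norm of `γ` may exceed the threshold of the conjecture, so the majorant is built from one
  -- tail whose logarithmic maximal function is integrable.
  obtain ⟨N, hN⟩ := ((tendsto_lintegral_logMaximal_lpTail hconj hγ).eventually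
    (gt_mem_nhds ENNReal.zero_lt_top)).exists
  have hfin := ae_lt_top (measurable_logMaximal (lpTail γ N)) hN.ne
  have hlogc : Continuous fun ξ : Circle =>
      |Real.log ‖(starPoly (N + 1) (orthonormalOPUC σ (N + 1))).eval (ξ : ℂ)‖| :=
    ((continuous_eval_circle _).norm.log fun ξ => norm_ne_zero_iff.2
      (eval_starPoly_orthonormalOPUC_ne_zero σ hσ _ ξ)).abs
  have hH : Integrable (fun ξ : Circle =>
      |Real.log ‖(starPoly (N + 1) (orthonormalOPUC σ (N + 1))).eval (ξ : ℂ)‖|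
        + (1 + (logMaximal (lpTail γ N) ξ).toReal)) circleMeasure :=
    hlogc.integrable_circle.add ((integrable_const 1).add
      (integrable_toReal_of_lintegral_ne_top (measurable_logMaximal _).aemeasurable hN.ne))
  have hdom : ∀ᶠ n in atTop, ∀ᵐ ξ : Circle ∂circleMeasure,
      |Real.log ‖(starPoly n (orthonormalOPUC σ n)).eval (ξ : ℂ)‖|
        ≤ |Real.log ‖(starPoly (N + 1) (orthonormalOPUC σ (N + 1))).eval (ξ : ℂ)‖|
          + (1 + (logMaximal (lpTail γ N) ξ).toReal) := by
    filter_upwards [eventually_ge_atTop (N + 1)] with n hn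
    obtain ⟨n, rfl⟩ : ∃ k, n = k + 1 := ⟨n - 1, by omega⟩
    filter_upwards [hfin] with ξ h
    exact abs_log_norm_starPoly_le σ hσ hγ hs ξ (norm_lpTail_lt_one hγ N)
      (fun k hk => by rw [lpTail_apply, if_pos hk])
      (fun k hk => by rw [lpTail_apply, if_neg (not_le.2 hk)]) h.ne (by omega)
  refine ⟨inSzegoClass_of_dominated σ hσ hL hL0 hH hdom hs1, ?_⟩
  filter_upwards [ae_isSzegoBoundaryValue σ hσ hL hL0 hH hdom hs1, hL, hL0] with ξ h1 h2 h3
  exact ⟨(L ξ)⁻¹, inv_ne_zero h3, h1, by rwa [inv_inv]⟩
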